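/- Let $1\le d<n$ be integers, $\sigma\ge 0$, and let $U\in\mathbb{R}^{n\times d}$ have orthonormal columns. Consider the joint distribution of $(x,y)$ given by $x=Uc$ and $y=x+z$, where $c\sim\mathcal N(0,I)$ in $\mathbb{R}^d$ and $z\sim\mathcal N(0,\sigma^2 I)$ in $\mathbb{R}^n$ are independent. For $W\in\mathbb{R}^{n\times n}$ let $R(W)=\frac1d\,\mathbb{E}\|Wy-x\|_2^2$ be the risk of the linear estimator $y\mapsto Wy$. The matrix $W^\ast=\frac{1}{1+\sigma^2}UU^T$ minimizes $R$ over all $W\in\mathbb{R}^{n\times n}$, and $R(W^\ast)=\frac{\sigma^2}{1+\sigma^2}$. Let $(x_1,y_1),\dots,(x_N,y_N)$ be drawn i.i.d. from the joint distribution, put $Y=[y_1,\dots,y_N]\in\mathbb{R}^{n\times N}$, and let $\hat U\in\mathbb{R}^{n\times d}$ consist of $d$ leading singular vectors of $YY^T$, i.e. of the first $d$ columns of the left factor of a singular value decomposition of $YY^T$ with singular values in decreasing order. Let $\hat W=\frac{1}{1+\sigma^2}\hat U\hat U^T$ be the PCA estimator. There is a numerical constant $c>0$ (independent of $n,d,N,\sigma,U$)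 such that, whenever $(d+n\sigma^2)\log n\le N$, with probability at least $1-n^{-10}-3e^{-d}+e^{-n}$ over the training set, every such choice of $\hat U$ satisfies $$R(\hat W)\le R(W^\ast)+c\,\frac{(d+n\sigma^2)\log n}{N}.$$ -/

import Mathlib

open MeasureTheory ProbabilityTheory
open scoped Matrix

noncomputable section

namespace SubspaceDenoising

/-- The joint law of a signal `x = U c` and its noisy observation `y = x + z`, where
`c ∼ N(0, I)` in `ℝᵈ` and `z ∼ N(0, σ² I)` in `ℝⁿ` are independent. -/
def jointLaw {n d : ℕ} (U : Matrix (Fin n) (Fin d) ℝ) (σ : ℝ) :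
    Measure (EuclideanSpace ℝ (Fin n) × EuclideanSpace ℝ (Fin n)) :=
  ((multivariateGaussian (0 : EuclideanSpace ℝ (Fin d)) (1 : Matrix (Fin d) (Fin d) ℝ)).prod
    (multivariateGaussian (0 : EuclideanSpace ℝ (Fin n))
      (σ ^ 2 • (1 : Matrix (Fin n) (Fin n) ℝ)))).map
    (fun p => (U.toEuclideanLin p.1, U.toEuclideanLin p.1 + p.2))

/-- The risk `R(W) = (1/d) 𝔼 ‖W y - x‖²` of the linear estimator `y ↦ W y`, where the
expectation is over a fresh pair `(x, y)`. -/
def risk {n d : ℕ} (U : Matrix (Fin n) (Fin d) ℝ) (σ : ℝ) (W : Matrix (Fin n) (Fin n) ℝ) : ℝ :=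
  (1 / (d : ℝ)) * ∫ p, ‖W.toEuclideanLin p.2 - p.1‖ ^ 2 ∂(jointLaw U σ)

/-- The scaled projection `(1 + σ²)⁻¹ V Vᵀ`: for `V = U` this is the optimal linear estimator,
and for `V = Û` it is the PCA estimator. -/
def projEst {n d : ℕ} (V : Matrix (Fin n) (Fin d) ℝ) (σ : ℝ) : Matrix (Fin n) (Fin n) ℝ :=
  (1 / (1 + σ ^ 2)) • (V * Vᵀ)

/-- The law of `N` i.i.d. training examples `(x₁, y₁), …, (x_N, y_N)`. -/
def trainingLaw {n d : ℕ} (U : Matrix (Fin n) (Fin d) ℝ) (σ : ℝ) (N : ℕ) :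
    Measure (Fin N → EuclideanSpace ℝ (Fin n) × EuclideanSpace ℝ (Fin n)) :=
  Measure.pi (fun _ => jointLaw U σ)

/-- The matrix `Y = [y₁, …, y_N]` whose columns are the noisy observations. -/
def obsMatrix {n N : ℕ} (D : Fin N → EuclideanSpace ℝ (Fin n) × EuclideanSpace ℝ (Fin n)) :
    Matrix (Fin n) (Fin N) ℝ :=
  Matrix.of fun i k => (D k).2 i

/-- `A = V diag(s) Wᵀ` is a singular value decomposition of the square matrix `A`, with the
singular values in decreasing order. -/
structure IsSVD {n : ℕ} (A V : Matrix (Fin n) (Fin n) ℝ) (s : Fin n → ℝ)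
    (W : Matrix (Fin n) (Fin n) ℝ) : Prop where
  left_orthogonal : V ∈ Matrix.orthogonalGroup (Fin n) ℝ
  right_orthogonal : W ∈ Matrix.orthogonalGroup (Fin n) ℝ
  nonneg : ∀ i, 0 ≤ s i
  antitone : Antitone s
  eq : A = V * Matrix.diagonal s * Wᵀ

/-- The columns of `Û` are `d` leading (left) singular vectors of `A`, i.e. the first `d` columns
of the left factor in some singular value decomposition of `A`. -/
def IsLeadingSingularVectors {n d : ℕ} (hd : d ≤ n) (A : Matrix (Fin n) (Fin n) ℝ)
    (Uhat : Matrix (Fin n) (Fin d) ℝ) : Prop :=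
  ∃ (V : Matrix (Fin n) (Fin n) ℝ) (s : Fin n → ℝ) (W : Matrix (Fin n) (Fin n) ℝ),
    IsSVD A V s W ∧ Uhat = V.submatrix id (Fin.castLE hd)

end SubspaceDenoising

end

/-! The risk of a linear estimator is explicit: `R(W) = (‖WU - U‖_F² + σ²‖W‖_F²) / d`. Completing a
square gives the optimal estimator. For `V` with orthonormal columns, the excess risk of its scaled
projection is `(1 + 2σ²)/(1 + σ²)² · D/d`, where `D = d - ‖UᵀV‖_F²` is the squared Frobenius `sin Θ`
distance. It remains to bound `D` for leading singular vectors of `G = YYᵀ`.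

By Ky Fan (`IsLeadingSingularVectors.trace_le`), such a `V` satisfies `tr UᵀGU ≤ tr VᵀGV`. Expanding
along the range of `U` and its complement (`sinTheta_bound`) gives `gap · D ≤ 2η √(dD)`, with `η`
the size of the off-diagonal block. The diagonal blocks of `G` are close to `N(1 + σ²)` and `Nσ²`.
They are needed only to accuracy `N/4`, which leaves a gap of `N/2`; the rate comes from the
off-diagonal block alone.

That block is a sum of products of independent Gaussians, since `y` along `U` is independent of `y`
across it. A self-normalized Chernoff bound over nets gives `η² ≲ N(1 + σ²)(d + nσ²)`, hence `D ≲
d(1 + σ²)(d + nσ²)/N`; the factor `1 + σ²` cancels in the excess risk. This requires `N ≳ (1 + σ²)(d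
+ nσ²)`. For smaller `N` the trivial bound `D ≤ d` already suffices. -/

namespace SubspaceDenoising

open Module
open scoped RealInnerProductSpace NNReal

/-! ### Leading singular vectors: Ky Fan's principle and subspace perturbation -/

open scoped MatrixOrder in
/-- Positive semidefinite square roots are unique. -/
lemma posSemidef_eq_of_mul_self_eq {n : ℕ} {A B : Matrix (Fin n) (Fin n) ℝ} (hA : A.PosSemidef)
    (hB : B.PosSemidef) (h : A * A = B * B) : A = B :=
  (CFC.mul_self_eq_mul_self_iff A B hA.nonneg hB.nonneg).1 h

/-- A singular value decomposition of a positive semidefinite matrix is a spectral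
decomposition. -/
lemma IsSVD.eq_conj_diagonal {n : ℕ} {A V W : Matrix (Fin n) (Fin n) ℝ} {s : Fin n → ℝ}
    (h : IsSVD A V s W) (hA : A.PosSemidef) : A = V * Matrix.diagonal s * Vᵀ := by
  have hV : Vᵀ * V = 1 := (Matrix.mem_orthogonalGroup_iff' _ _).1 h.left_orthogonal
  have hW : Wᵀ * W = 1 := (Matrix.mem_orthogonalGroup_iff' _ _).1 h.right_orthogonal
  have hAt : Aᵀ = A := by simpa using hA.isHermitian.eq
  have hps : (V * Matrix.diagonal s * Vᵀ).PosSemidef := by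
    simpa using (Matrix.PosSemidef.diagonal (fun i => h.nonneg i)).mul_mul_conjTranspose_same V
  -- `W` may differ from `V` on the kernel of `A`, so the two are not compared directly: both sides
  -- are positive semidefinite square roots of `A Aᵀ`, in which `W` cancels.
  refine posSemidef_eq_of_mul_self_eq hA hps ?_
  calc A * A = A * Aᵀ := by rw [hAt]
    _ = V * Matrix.diagonal s * (Wᵀ * W) * Matrix.diagonal s * Vᵀ := by
        rw [h.eq]
        simp only [Matrix.transpose_mul, Matrix.transpose_transpose, Matrix.diagonal_transpose,
          Matrix.mul_assoc]
    _ = V * Matrix.diagonal s * (Vᵀ * V) * Matrix.diagonal s * Vᵀ := by rw [hW, hV]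
    _ = _ := by simp only [Matrix.mul_assoc]

lemma trace_transpose_mul_mul_eq_sum {n m : ℕ} (A : Matrix (Fin n) (Fin n) ℝ)
    (M M' : Matrix (Fin n) (Fin m) ℝ) :
    (Mᵀ * A * M').trace = ∑ j, (M.col j) ⬝ᵥ A *ᵥ (M'.col j) := by
  simp only [Matrix.trace, Matrix.diag, Matrix.mul_assoc]
  rfl

lemma trace_transpose_mul_self_eq_sum {n m : ℕ} (M : Matrix (Fin n) (Fin m) ℝ) :
    (Mᵀ * M).trace = ∑ j, (M.col j) ⬝ᵥ (M.col j) := rfl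

lemma dotProduct_self_nonneg' {m : ℕ} (v : Fin m → ℝ) : 0 ≤ v ⬝ᵥ v :=
  Finset.sum_nonneg fun i _ => mul_self_nonneg (v i)

lemma trace_transpose_mul_self_nonneg {n m : ℕ} (M : Matrix (Fin n) (Fin m) ℝ) :
    0 ≤ (Mᵀ * M).trace := by
  rw [trace_transpose_mul_self_eq_sum]
  exact Finset.sum_nonneg fun j _ => dotProduct_self_nonneg' _

/-- If `U` has orthonormal columns then `‖Uᵀ M‖_F² ≤ ‖M‖_F²`, with the defect made explicit. -/
lemma trace_projection_complement {n d m : ℕ} {U : Matrix (Fin n) (Fin d) ℝ} (hU : Uᵀ * U = 1)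
    (M : Matrix (Fin n) (Fin m) ℝ) :
    (M - U * (Uᵀ * M))ᵀ * (M - U * (Uᵀ * M)) = Mᵀ * M - (Uᵀ * M)ᵀ * (Uᵀ * M) := by
  have h : Uᵀ * (M - U * (Uᵀ * M)) = 0 := by
    rw [Matrix.mul_sub, ← Matrix.mul_assoc Uᵀ U, hU, Matrix.one_mul, sub_self]
  rw [Matrix.transpose_sub, Matrix.sub_mul, Matrix.transpose_mul U, Matrix.mul_assoc _ Uᵀ, h,
    Matrix.mul_zero, sub_zero, Matrix.mul_sub]
  simp only [Matrix.transpose_mul, Matrix.transpose_transpose, Matrix.mul_assoc]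

/-- The defect is the squared Frobenius norm of the part of `M` orthogonal to the range of `U`. -/
lemma trace_transpose_mul_le {n d m : ℕ} {U : Matrix (Fin n) (Fin d) ℝ} (hU : Uᵀ * U = 1)
    (M : Matrix (Fin n) (Fin m) ℝ) :
    ((Uᵀ * M)ᵀ * (Uᵀ * M)).trace ≤ (Mᵀ * M).trace := by
  have := trace_transpose_mul_self_nonneg (M - U * (Uᵀ * M))
  rw [trace_projection_complement hU, Matrix.trace_sub] at this
  linarith

/-- The weighted sum of an antitone sequence with weights in `[0, 1]` of total mass `d` is at most
the sum of its first `d` terms. -/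
lemma sum_mul_le_sum_castLE {n d : ℕ} (hdn : d < n) {s r : Fin n → ℝ} (hs : Antitone s)
    (h0 : ∀ i, 0 ≤ r i) (h1 : ∀ i, r i ≤ 1) (hr : ∑ i, r i = d) :
    ∑ i, s i * r i ≤ ∑ j : Fin d, s (Fin.castLE hdn.le j) := by
  let e : Fin n → ℝ := fun i => if (i : ℕ) < d then 1 else 0
  have key : ∀ f : Fin n → ℝ, ∑ i, f i * e i = ∑ j : Fin d, f (Fin.castLE hdn.le j) := by
    intro f
    simp only [e, mul_ite, mul_one, mul_zero]
    rw [← Finset.sum_filter]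
    symm
    refine Finset.sum_bij (fun j _ => Fin.castLE hdn.le j) ?_ ?_ ?_ ?_
    · intro j _; simp
    · intro a _ b _ h; simpa using h
    · intro i hi
      exact ⟨⟨i, by simpa using hi⟩, Finset.mem_univ _, rfl⟩
    · intro j _; rfl
  have he : ∑ i, e i = d := by simpa using key (fun _ => 1)
  -- Compare with the pivot value at index `d`: both factors are nonnegative before it and
  -- nonpositive from it on. The pivot term drops out after summation because `e` and `r` have the
  -- same mass.
  have hpt : ∀ i, 0 ≤ (s i - s ⟨d, hdn⟩) * (e i - r i) := by
    intro i
    by_cases hi : (i : ℕ) < d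
    · have : s ⟨d, hdn⟩ ≤ s i := hs (Fin.le_def.2 hi.le)
      simp only [e, if_pos hi]
      exact mul_nonneg (by linarith) (by linarith [h1 i])
    · have : s i ≤ s ⟨d, hdn⟩ := hs (Fin.le_def.2 (not_lt.1 hi))
      simp only [e, if_neg hi]
      exact mul_nonneg_of_nonpos_of_nonpos (by linarith) (by linarith [h0 i])
  have hsum := Finset.sum_nonneg fun i (_ : i ∈ Finset.univ) => hpt i
  have hexp : ∑ i, (s i - s ⟨d, hdn⟩) * (e i - r i)
      = ∑ i, s i * e i - ∑ i, s i * r i - s ⟨d, hdn⟩ * (∑ i, e i - ∑ i, r i) := by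
    rw [← Finset.sum_sub_distrib, ← Finset.sum_sub_distrib, Finset.mul_sum,
      ← Finset.sum_sub_distrib]
    exact Finset.sum_congr rfl fun i _ => by ring
  rw [hexp, he, hr, key] at hsum
  linarith

lemma submatrix_castLE_transpose_mul_self {n d : ℕ} (hdn : d ≤ n) {V : Matrix (Fin n) (Fin n) ℝ}
    (hV : Vᵀ * V = 1) :
    (V.submatrix id (Fin.castLE hdn))ᵀ * V.submatrix id (Fin.castLE hdn) = 1 := by
  have : (V.submatrix id (Fin.castLE hdn))ᵀ * V.submatrix id (Fin.castLE hdn)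
      = (Vᵀ * V).submatrix (Fin.castLE hdn) (Fin.castLE hdn) := by
    ext i j; simp [Matrix.mul_apply]
  rw [this, hV]
  exact Matrix.submatrix_one _ (Fin.castLE_injective hdn)

lemma IsLeadingSingularVectors.transpose_mul_self {n d : ℕ} {hdn : d ≤ n}
    {A : Matrix (Fin n) (Fin n) ℝ} {V : Matrix (Fin n) (Fin d) ℝ}
    (h : IsLeadingSingularVectors hdn A V) : Vᵀ * V = 1 := by
  obtain ⟨V, s, W, hsvd, rfl⟩ := h
  exact submatrix_castLE_transpose_mul_self hdn
    ((Matrix.mem_orthogonalGroup_iff' _ _).1 hsvd.left_orthogonal)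

/-- **Ky Fan's maximum principle**: leading singular vectors of a positive semidefinite matrix
maximize the trace of its compression to a `d`-dimensional subspace. -/
lemma IsLeadingSingularVectors.trace_le {n d : ℕ} (hdn : d < n)
    {A : Matrix (Fin n) (Fin n) ℝ} (hA : A.PosSemidef) {V : Matrix (Fin n) (Fin d) ℝ}
    (h : IsLeadingSingularVectors hdn.le A V) {U : Matrix (Fin n) (Fin d) ℝ} (hU : Uᵀ * U = 1) :
    (Uᵀ * A * U).trace ≤ (Vᵀ * A * V).trace := by
  obtain ⟨V, s, W, hsvd, rfl⟩ := h
  have hV : Vᵀ * V = 1 := (Matrix.mem_orthogonalGroup_iff' _ _).1 hsvd.left_orthogonal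
  have hV' : V * Vᵀ = 1 := (Matrix.mem_orthogonalGroup_iff _ _).1 hsvd.left_orthogonal
  have hAeq := hsvd.eq_conj_diagonal hA
  have hVA : ((V.submatrix id (Fin.castLE hdn.le))ᵀ * A * V.submatrix id (Fin.castLE hdn.le)).trace
      = ∑ j : Fin d, s (Fin.castLE hdn.le j) := by
    have : (V.submatrix id (Fin.castLE hdn.le))ᵀ * A * V.submatrix id (Fin.castLE hdn.le)
        = (Vᵀ * A * V).submatrix (Fin.castLE hdn.le) (Fin.castLE hdn.le) := by
      ext i j; simp [Matrix.mul_apply]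
    have h2 : Vᵀ * A * V = Matrix.diagonal s := by
      rw [hAeq]
      calc Vᵀ * (V * Matrix.diagonal s * Vᵀ) * V
          = (Vᵀ * V) * Matrix.diagonal s * (Vᵀ * V) := by simp only [Matrix.mul_assoc]
        _ = _ := by rw [hV]; simp
    rw [this, h2]
    simp [Matrix.trace]
  set B := Vᵀ * U with hB
  have hUA : (Uᵀ * A * U).trace = ∑ i, s i * ∑ j, B i j ^ 2 := by
    have : Uᵀ * A * U = Bᵀ * Matrix.diagonal s * B := by
      rw [hAeq, hB]
      simp only [Matrix.transpose_mul, Matrix.transpose_transpose, Matrix.mul_assoc]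
    rw [this, Matrix.mul_assoc, Matrix.trace_mul_comm, Matrix.mul_assoc, Matrix.trace]
    refine Finset.sum_congr rfl fun i _ => ?_
    rw [Matrix.diag_apply, Matrix.diagonal_mul, Matrix.mul_apply]
    simp [sq]
  have hBB : Bᵀ * B = 1 := by
    rw [hB, Matrix.transpose_mul, Matrix.transpose_transpose, Matrix.mul_assoc,
      ← Matrix.mul_assoc V, hV', Matrix.one_mul, hU]
  rw [hUA, hVA]
  refine sum_mul_le_sum_castLE hdn hsvd.antitone
    (fun i => Finset.sum_nonneg fun j _ => sq_nonneg _) ?_ ?_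
  · intro i
    -- The `i`-th weight is the squared norm of the `i`-th row of `B`, that is `‖Bᵀ eᵢ‖²`, so it is
    -- at most `‖eᵢ‖² = 1`.
    have h1 := trace_transpose_mul_le hBB (Matrix.of fun k (_ : Fin 1) => if k = i then (1 : ℝ) else 0)
    simpa [Matrix.trace, Matrix.mul_apply, sq] using h1
  · have : (Bᵀ * B).trace = d := by rw [hBB]; simp
    rw [← this, Matrix.trace, Finset.sum_comm]
    refine Finset.sum_congr rfl fun i _ => ?_
    simp [Matrix.mul_apply, sq]

/-- **Perturbation bound for leading singular subspaces**: a separation `lam - mu` between the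
compressions of `G` to the range of `U` and to its orthogonal complement, together with a bound
`eta` for the off-diagonal block, controls the squared Frobenius `sin Θ` distance. -/
lemma sinTheta_bound {n d : ℕ} {U V : Matrix (Fin n) (Fin d) ℝ} (hU : Uᵀ * U = 1)
    (hV : Vᵀ * V = 1) {G : Matrix (Fin n) (Fin n) ℝ} (hG : Gᵀ = G) {lam mu eta : ℝ} (heta : 0 ≤ eta)
    (hmax : (Uᵀ * G * U).trace ≤ (Vᵀ * G * V).trace)
    (h1 : ∀ v : Fin d → ℝ, lam * (v ⬝ᵥ v) ≤ v ⬝ᵥ (Uᵀ * G * U) *ᵥ v)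
    (h2 : ∀ w : Fin n → ℝ, Uᵀ *ᵥ w = 0 → w ⬝ᵥ G *ᵥ w ≤ mu * (w ⬝ᵥ w))
    (h3 : ∀ (v : Fin d → ℝ) (w : Fin n → ℝ), Uᵀ *ᵥ w = 0 →
      (U *ᵥ v) ⬝ᵥ G *ᵥ w ≤ eta * (√(v ⬝ᵥ v) * √(w ⬝ᵥ w))) :
    (lam - mu) * (d - ((Uᵀ * V)ᵀ * (Uᵀ * V)).trace) ≤
      2 * eta * √(d * (d - ((Uᵀ * V)ᵀ * (Uᵀ * V)).trace)) := by
  set Φ := Uᵀ * V with hΦ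
  set D := (d : ℝ) - (Φᵀ * Φ).trace with hD
  -- `Ψ` is the residual of `V` off the range of `U`, and `Θ` that of `U` off the range of `V`. Both
  -- have squared Frobenius norm `D`.
  set Ψ := V - U * Φ with hΨ
  set Θ := U - V * Φᵀ with hΘ
  have hΨΨ : Ψᵀ * Ψ = 1 - Φᵀ * Φ := by rw [hΨ, hΦ, trace_projection_complement hU, hV]
  have hΦt : Φᵀ = Vᵀ * U := by rw [hΦ, Matrix.transpose_mul, Matrix.transpose_transpose]
  have hΘΘ : Θᵀ * Θ = 1 - Φ * Φᵀ := by
    have := trace_projection_complement hV U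
    rw [← hΦt, hU, Matrix.transpose_transpose] at this
    exact this
  have hUΨ : Uᵀ * Ψ = 0 := by
    rw [hΨ, Matrix.mul_sub, ← Matrix.mul_assoc, hU, Matrix.one_mul, sub_self]
  have hUΨcol : ∀ j, Uᵀ *ᵥ Ψ.col j = 0 := fun j => by
    ext i
    exact congrFun (congrFun hUΨ i) j
  have hDΨ : ∑ j, Ψ.col j ⬝ᵥ Ψ.col j = D := by
    rw [← trace_transpose_mul_self_eq_sum, hΨΨ, Matrix.trace_sub, hD]; simp
  have hDΘ : (Θᵀ * Θ).trace = D := by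
    rw [hΘΘ, Matrix.trace_sub, hD, Matrix.trace_mul_comm]; simp
  have hD0 : 0 ≤ D := by rw [← hDΘ]; exact trace_transpose_mul_self_nonneg Θ
  have hVeq : V = U * Φ + Ψ := by rw [hΨ]; abel
  set K := Uᵀ * G * U with hK
  have hexp : (Vᵀ * G * V).trace
      = (Φᵀ * K * Φ).trace + 2 * ((U * Φ)ᵀ * G * Ψ).trace + (Ψᵀ * G * Ψ).trace := by
    have hsym : (Ψᵀ * G * (U * Φ)).trace = ((U * Φ)ᵀ * G * Ψ).trace := by
      rw [← Matrix.trace_transpose]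
      simp only [Matrix.transpose_mul, Matrix.transpose_transpose, hG, Matrix.mul_assoc]
    have : Vᵀ * G * V = (U * Φ)ᵀ * G * (U * Φ) + (U * Φ)ᵀ * G * Ψ + Ψᵀ * G * (U * Φ)
        + Ψᵀ * G * Ψ := by
      conv_lhs => rw [hVeq]
      rw [Matrix.transpose_add, Matrix.add_mul, Matrix.add_mul, Matrix.mul_add, Matrix.mul_add]
      abel
    rw [this, Matrix.trace_add, Matrix.trace_add, Matrix.trace_add, hsym]
    have : (U * Φ)ᵀ * G * (U * Φ) = Φᵀ * K * Φ := by
      rw [hK]; simp only [Matrix.transpose_mul, Matrix.mul_assoc]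
    rw [this]; ring
  -- The loss is `tr K(1 - ΦΦᵀ) = tr ΘKΘᵀ`, so the lower bound on `K` applies to each row of `Θ`.
  have hlow : lam * D ≤ K.trace - (Φᵀ * K * Φ).trace := by
    have e1 : K.trace - (Φᵀ * K * Φ).trace = (Θᵀᵀ * K * Θᵀ).trace := by
      rw [Matrix.transpose_transpose, Matrix.trace_mul_comm (Θ * K), ← Matrix.mul_assoc Θᵀ,
        hΘΘ, Matrix.sub_mul, Matrix.one_mul, Matrix.trace_sub, Matrix.mul_assoc Φ,
        Matrix.trace_mul_comm Φ]
    rw [e1, trace_transpose_mul_mul_eq_sum, ← hDΘ, Matrix.trace_mul_comm]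
    have e2 : (Θ * Θᵀ).trace = ∑ j, (Θᵀ).col j ⬝ᵥ (Θᵀ).col j := by
      rw [← trace_transpose_mul_self_eq_sum, Matrix.transpose_transpose]
    rw [e2, Finset.mul_sum]
    exact Finset.sum_le_sum fun j _ => h1 _
  have hup : (Ψᵀ * G * Ψ).trace ≤ mu * D := by
    rw [trace_transpose_mul_mul_eq_sum, ← hDΨ, Finset.mul_sum]
    exact Finset.sum_le_sum fun j _ => h2 _ (hUΨcol j)
  -- The columns of `Φ` have norm at most 1, and Cauchy–Schwarz bounds the sum of the `d` column
  -- norms of `Ψ` by `√(dD)`.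
  have hcross : ((U * Φ)ᵀ * G * Ψ).trace ≤ eta * √(d * D) := by
    have hΦ1 : ∀ j, √(Φ.col j ⬝ᵥ Φ.col j) ≤ 1 := fun j => by
      refine Real.sqrt_le_one.2 ?_
      have e := congrFun (congrFun hΨΨ j) j
      have e' : Ψ.col j ⬝ᵥ Ψ.col j = 1 - Φ.col j ⬝ᵥ Φ.col j := by
        have : (1 : Matrix (Fin d) (Fin d) ℝ) j j = 1 := Matrix.one_apply_eq j
        rw [Matrix.sub_apply, this] at e
        exact e
      linarith [dotProduct_self_nonneg' (Ψ.col j)]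
    have hcs : ∑ j, √(Ψ.col j ⬝ᵥ Ψ.col j) ≤ √(d * D) := by
      refine Real.le_sqrt_of_sq_le ?_
      have := sq_sum_le_card_mul_sum_sq (s := Finset.univ) (f := fun j => √(Ψ.col j ⬝ᵥ Ψ.col j))
      simp only [Real.sq_sqrt (dotProduct_self_nonneg' _), hDΨ, Finset.card_univ,
        Fintype.card_fin] at this
      exact this
    rw [trace_transpose_mul_mul_eq_sum]
    calc ∑ j, (U * Φ).col j ⬝ᵥ G *ᵥ Ψ.col j
        ≤ ∑ j, eta * √(Ψ.col j ⬝ᵥ Ψ.col j) := by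
          refine Finset.sum_le_sum fun j _ => ?_
          have := h3 (Φ.col j) (Ψ.col j) (hUΨcol j)
          refine this.trans (mul_le_mul_of_nonneg_left ?_ heta)
          exact mul_le_of_le_one_left (Real.sqrt_nonneg _) (hΦ1 j)
      _ ≤ _ := by
          rw [← Finset.mul_sum]
          exact mul_le_mul_of_nonneg_left hcs heta
  nlinarith

/-- Squaring cancels one factor `D`, which makes the bound quadratic in `eta`; this produces the
rate `1/N` rather than `1/√N`. -/
lemma sinTheta_bound_sq {d : ℕ} {D g eta : ℝ} (hg : 0 < g) (hD : 0 ≤ D)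
    (h : g * D ≤ 2 * eta * √(d * D)) : D ≤ 4 * eta ^ 2 * d / g ^ 2 := by
  rcases hD.eq_or_lt with rfl | hD'
  · positivity
  rw [le_div_iff₀ (by positivity)]
  have h2 : (g * D) ^ 2 ≤ (2 * eta * √(d * D)) ^ 2 :=
    pow_le_pow_left₀ (by positivity) h 2
  rw [mul_pow _ (√_), Real.sq_sqrt (by positivity)] at h2
  nlinarith

/-! ### Gaussian source and noise, and the closed form of the risk -/

lemma posSemidef_sq_smul_one (n : ℕ) (σ : ℝ) :
    (σ ^ 2 • (1 : Matrix (Fin n) (Fin n) ℝ)).PosSemidef :=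
  Matrix.PosSemidef.one.smul (sq_nonneg σ)

lemma map_inner_multivariateGaussian {n : ℕ} (σ : ℝ) (q : EuclideanSpace ℝ (Fin n)) :
    (multivariateGaussian (0 : EuclideanSpace ℝ (Fin n))
      (σ ^ 2 • (1 : Matrix (Fin n) (Fin n) ℝ))).map (fun x => ⟪q, x⟫) =
      gaussianReal 0 (σ ^ 2 * ‖q‖ ^ 2).toNNReal := by
  have h := IsGaussian.map_eq_gaussianReal (μ := multivariateGaussian
    (0 : EuclideanSpace ℝ (Fin n)) (σ ^ 2 • (1 : Matrix (Fin n) (Fin n) ℝ))) (innerSL ℝ q)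
  have hmean : ∫ x, (innerSL ℝ q) x ∂(multivariateGaussian
    (0 : EuclideanSpace ℝ (Fin n)) (σ ^ 2 • (1 : Matrix (Fin n) (Fin n) ℝ))) = 0 := by
    rw [(innerSL ℝ q).integral_comp_id_comm IsGaussian.integrable_id]
    simp
  have hvar : Var[innerSL ℝ q; multivariateGaussian
    (0 : EuclideanSpace ℝ (Fin n)) (σ ^ 2 • (1 : Matrix (Fin n) (Fin n) ℝ))]
      = σ ^ 2 * ‖q‖ ^ 2 := by
    have h1 := covarianceBilin_multivariateGaussian (μ := (0 : EuclideanSpace ℝ (Fin n)))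
      (posSemidef_sq_smul_one n σ) q q
    rw [covarianceBilin_self IsGaussian.memLp_two_id] at h1
    change Var[fun u => ⟪q, u⟫; _] = _
    rw [h1, EuclideanSpace.real_norm_sq_eq]
    rw [Matrix.smul_mulVec, Matrix.one_mulVec, dotProduct_smul]
    simp [dotProduct, sq]
  rw [hmean, hvar] at h
  exact h

/-- The joint law of the Gaussian source `c` and the Gaussian noise `z`. -/
noncomputable def sourceLaw (n d : ℕ) (σ : ℝ) :
    Measure (EuclideanSpace ℝ (Fin d) × EuclideanSpace ℝ (Fin n)) :=
  (multivariateGaussian (0 : EuclideanSpace ℝ (Fin d)) (1 : Matrix (Fin d) (Fin d) ℝ)).prod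
    (multivariateGaussian (0 : EuclideanSpace ℝ (Fin n))
      (σ ^ 2 • (1 : Matrix (Fin n) (Fin n) ℝ)))

instance (n d : ℕ) (σ : ℝ) : IsProbabilityMeasure (sourceLaw n d σ) := by
  unfold sourceLaw; infer_instance

instance (n d : ℕ) (σ : ℝ) : IsGaussian (sourceLaw n d σ) := by
  unfold sourceLaw; infer_instance

lemma map_inner_add_inner_sourceLaw {n d : ℕ} (σ : ℝ) (p : EuclideanSpace ℝ (Fin d))
    (q : EuclideanSpace ℝ (Fin n)) :
    (sourceLaw n d σ).map (fun w => ⟪p, w.1⟫ + ⟪q, w.2⟫) =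
      gaussianReal 0 (‖p‖ ^ 2 + σ ^ 2 * ‖q‖ ^ 2).toNNReal := by
  have hind : IndepFun (fun w : EuclideanSpace ℝ (Fin d) × EuclideanSpace ℝ (Fin n) => ⟪p, w.1⟫)
      (fun w => ⟪q, w.2⟫) (sourceLaw n d σ) := by
    unfold sourceLaw
    exact indepFun_prod (X := fun x => ⟪p, x⟫) (Y := fun x => ⟪q, x⟫) (by fun_prop) (by fun_prop)
  have h1 : (sourceLaw n d σ).map (fun w => ⟪p, w.1⟫) = gaussianReal 0 (‖p‖ ^ 2).toNNReal := by
    have := map_inner_multivariateGaussian 1 p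
    simp only [one_pow, one_smul, one_mul] at this
    rw [← this]
    change (sourceLaw n d σ).map ((fun x => ⟪p, x⟫) ∘ Prod.fst) = _
    rw [← Measure.map_map (by fun_prop) (by fun_prop)]
    congr 1
    exact Measure.fst_prod
  have h2 : (sourceLaw n d σ).map (fun w => ⟪q, w.2⟫)
      = gaussianReal 0 (σ ^ 2 * ‖q‖ ^ 2).toNNReal := by
    rw [← map_inner_multivariateGaussian]
    change (sourceLaw n d σ).map ((fun x => ⟪q, x⟫) ∘ Prod.snd) = _
    rw [← Measure.map_map (by fun_prop) (by fun_prop)]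
    congr 1
    exact Measure.snd_prod
  have h := gaussianReal_add_gaussianReal_of_indepFun hind h1 h2
  rw [add_zero, ← Real.toNNReal_add (by positivity) (by positivity)] at h
  exact h

lemma jointLaw_eq_map {n d : ℕ} (U : Matrix (Fin n) (Fin d) ℝ) (σ : ℝ) :
    jointLaw U σ = (sourceLaw n d σ).map
      (fun p => (U.toEuclideanLin p.1, U.toEuclideanLin p.1 + p.2)) := rfl

lemma measurable_toEuclideanLin {n d : ℕ} (U : Matrix (Fin n) (Fin d) ℝ) :
    Measurable U.toEuclideanLin :=
  (LinearMap.continuous_of_finiteDimensional _).measurable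

lemma measurable_signal_observation {n d : ℕ} (U : Matrix (Fin n) (Fin d) ℝ) :
    Measurable (fun p : EuclideanSpace ℝ (Fin d) × EuclideanSpace ℝ (Fin n) =>
      (U.toEuclideanLin p.1, U.toEuclideanLin p.1 + p.2)) := by
  have := measurable_toEuclideanLin U
  fun_prop

instance {n d : ℕ} (U : Matrix (Fin n) (Fin d) ℝ) (σ : ℝ) : IsProbabilityMeasure (jointLaw U σ) :=
  Measure.isProbabilityMeasure_map (measurable_signal_observation U).aemeasurable

lemma integrable_sq_and_integral_sq_of_map_gaussianReal {Ω : Type*} [MeasurableSpace Ω]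
    {P : Measure Ω} {X : Ω → ℝ} (hX : Measurable X) {v : ℝ} (hv : 0 ≤ v)
    (h : P.map X = gaussianReal 0 v.toNNReal) :
    Integrable (fun ω => X ω ^ 2) P ∧ ∫ ω, X ω ^ 2 ∂P = v := by
  have hi : Integrable (fun x : ℝ => x ^ 2) (P.map X) := by
    rw [h]; exact (memLp_id_gaussianReal 2).integrable_sq
  refine ⟨hi.comp_measurable hX, ?_⟩
  rw [← integral_map hX.aemeasurable hi.aestronglyMeasurable, h]
  have := variance_id_gaussianReal (μ := 0) (v := v.toNNReal)
  rw [variance_eq_integral aemeasurable_id] at this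
  simpa [integral_id_gaussianReal, hv] using this

/-- The risk of a linear estimator in terms of Frobenius norms. -/
lemma risk_eq {n d : ℕ} (U : Matrix (Fin n) (Fin d) ℝ) (σ : ℝ) (W : Matrix (Fin n) (Fin n) ℝ) :
    risk U σ W = (1 / (d : ℝ)) *
      (((W * U - U)ᵀ * (W * U - U)).trace + σ ^ 2 * (Wᵀ * W).trace) := by
  unfold risk
  congr 1
  rw [jointLaw_eq_map, integral_map (measurable_signal_observation U).aemeasurable]
  swap
  · have := measurable_toEuclideanLin W
    exact Measurable.aestronglyMeasurable (by fun_prop)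
  -- Each coordinate of the error `(WU - U)c + Wz` is a centered Gaussian built from the `i`-th rows
  -- of `WU - U` and `W`.
  let p : Fin n → EuclideanSpace ℝ (Fin d) := fun i => WithLp.toLp 2 ((W * U - U) i)
  let q : Fin n → EuclideanSpace ℝ (Fin n) := fun i => WithLp.toLp 2 (W i)
  have hpt : ∀ w : EuclideanSpace ℝ (Fin d) × EuclideanSpace ℝ (Fin n),
      ‖W.toEuclideanLin (U.toEuclideanLin w.1 + w.2) - U.toEuclideanLin w.1‖ ^ 2
        = ∑ i, (⟪p i, w.1⟫ + ⟪q i, w.2⟫) ^ 2 := by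
    intro w
    rw [EuclideanSpace.real_norm_sq_eq]
    refine Finset.sum_congr rfl fun i _ => ?_
    congr 1
    have e1 : ⟪p i, w.1⟫ = ((W * U - U) *ᵥ w.1.ofLp) i := by
      rw [PiLp.inner_apply]; simp [p, Matrix.mulVec, dotProduct, mul_comm]
    have e2 : ⟪q i, w.2⟫ = (W *ᵥ w.2.ofLp) i := by
      rw [PiLp.inner_apply]; simp [q, Matrix.mulVec, dotProduct, mul_comm]
    rw [e1, e2, Matrix.sub_mulVec, ← Matrix.mulVec_mulVec, map_add]
    simp [Matrix.toLpLin_apply]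
    ring
  simp_rw [hpt]
  have hg := fun i => integrable_sq_and_integral_sq_of_map_gaussianReal (P := sourceLaw n d σ)
    (X := fun w => ⟪p i, w.1⟫ + ⟪q i, w.2⟫) (by fun_prop) (v := ‖p i‖ ^ 2 + σ ^ 2 * ‖q i‖ ^ 2)
    (by positivity) (map_inner_add_inner_sourceLaw σ (p i) (q i))
  rw [integral_finsetSum _ fun i _ => (hg i).1]
  simp_rw [(hg _).2]
  rw [Finset.sum_add_distrib, ← Finset.mul_sum, Matrix.trace_mul_comm, Matrix.trace_mul_comm Wᵀ]
  congr 1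
  · refine Finset.sum_congr rfl fun i _ => ?_
    rw [EuclideanSpace.real_norm_sq_eq, Matrix.diag_apply, Matrix.mul_apply]
    simp [p, sq]
  · congr 1
    refine Finset.sum_congr rfl fun i _ => ?_
    rw [EuclideanSpace.real_norm_sq_eq, Matrix.diag_apply, Matrix.mul_apply]
    simp [q, sq]

/-- The risk of the scaled projection onto the column space of `V`. -/
lemma risk_projEst {n d : ℕ} (hd : 1 ≤ d) {U V : Matrix (Fin n) (Fin d) ℝ} (hU : Uᵀ * U = 1)
    (hV : Vᵀ * V = 1) (σ : ℝ) :
    risk U σ (projEst V σ) = σ ^ 2 / (1 + σ ^ 2) +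
      (1 + 2 * σ ^ 2) / (1 + σ ^ 2) ^ 2 * (d - ((Uᵀ * V)ᵀ * (Uᵀ * V)).trace) / d := by
  have hd' : (d : ℝ) ≠ 0 := by positivity
  have hs : (1 + σ ^ 2) ≠ 0 := by positivity
  set α := 1 / (1 + σ ^ 2) with hα
  set T := ((Uᵀ * V)ᵀ * (Uᵀ * V)).trace with hT
  have hPP : (V * Vᵀ) * (V * Vᵀ) = V * Vᵀ := by
    rw [Matrix.mul_assoc, ← Matrix.mul_assoc Vᵀ, hV, Matrix.one_mul]
  have hPt : (V * Vᵀ)ᵀ = V * Vᵀ := by rw [Matrix.transpose_mul, Matrix.transpose_transpose]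
  have hTr : (Uᵀ * (V * Vᵀ * U)).trace = T := by
    rw [hT, Matrix.transpose_mul, Matrix.transpose_transpose, Matrix.trace_mul_comm (Vᵀ * U)]
    simp only [Matrix.mul_assoc]
  have h1 : (((projEst V σ) * U - U)ᵀ * ((projEst V σ) * U - U)).trace
      = d - (2 * α - α ^ 2) * T := by
    have e : ((projEst V σ) * U - U)ᵀ * ((projEst V σ) * U - U)
        = (α ^ 2 - 2 * α) • (Uᵀ * (V * Vᵀ * U)) + Uᵀ * U := by
      rw [projEst, ← hα, Matrix.smul_mul, Matrix.transpose_sub, Matrix.transpose_smul,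
        Matrix.transpose_mul, hPt, Matrix.sub_mul, Matrix.mul_sub, Matrix.mul_sub]
      simp only [Matrix.smul_mul, Matrix.mul_smul]
      have e2 : Uᵀ * (V * Vᵀ) * (V * Vᵀ * U) = Uᵀ * (V * Vᵀ * U) := by
        rw [Matrix.mul_assoc, ← Matrix.mul_assoc (V * Vᵀ), hPP]
      rw [e2, Matrix.mul_assoc Uᵀ]
      module
    rw [e, Matrix.trace_add, Matrix.trace_smul, hTr, hU]
    simp
    ring
  have h2 : ((projEst V σ)ᵀ * (projEst V σ)).trace = α ^ 2 * d := by
    have : (projEst V σ)ᵀ * (projEst V σ) = α ^ 2 • (V * Vᵀ) := by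
      rw [projEst, ← hα, Matrix.transpose_smul, hPt, Matrix.smul_mul, Matrix.mul_smul, hPP,
        smul_smul, sq]
    rw [this, Matrix.trace_smul, Matrix.trace_mul_comm, hV]
    simp
  rw [risk_eq, h1, h2, hα]
  field_simp
  ring

/-- The risk of the optimal linear estimator. -/
lemma risk_projEst_self {n d : ℕ} (hd : 1 ≤ d) {U : Matrix (Fin n) (Fin d) ℝ} (hU : Uᵀ * U = 1)
    (σ : ℝ) : risk U σ (projEst U σ) = σ ^ 2 / (1 + σ ^ 2) := by
  rw [risk_projEst hd hU hU, hU]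
  simp

/-- No linear estimator beats the scaled projection onto the signal subspace. -/
lemma risk_projEst_self_le {n d : ℕ} (hd : 1 ≤ d) {U : Matrix (Fin n) (Fin d) ℝ} (hU : Uᵀ * U = 1)
    (σ : ℝ) (W : Matrix (Fin n) (Fin n) ℝ) : risk U σ (projEst U σ) ≤ risk U σ W := by
  have hd' : (0 : ℝ) < d := by exact_mod_cast hd
  have hs : 0 < 1 + σ ^ 2 := by positivity
  rw [risk_projEst_self hd hU, risk_eq]
  have hWU : ((W * U)ᵀ * (W * U)).trace ≤ (Wᵀ * W).trace := by
    have := trace_transpose_mul_le hU Wᵀ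
    rw [Matrix.trace_mul_comm, Matrix.trace_mul_comm Wᵀᵀ] at this
    rw [Matrix.transpose_transpose, Matrix.transpose_mul Uᵀ, Matrix.transpose_transpose,
      Matrix.transpose_transpose, Matrix.trace_mul_comm,
      ← Matrix.transpose_transpose U, ← Matrix.transpose_mul, Matrix.transpose_transpose] at this
    rwa [Matrix.trace_mul_comm]
  set M := W * U with hM
  -- With `‖WU‖_F ≤ ‖W‖_F`, the quantity `(1 + σ²) d R(W)` is at least `‖(1 + σ²)M - U‖_F² + σ² d`.
  have hsq := trace_transpose_mul_self_nonneg ((1 + σ ^ 2) • M - U)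
  have hcomm : (Uᵀ * M).trace = (Mᵀ * U).trace := by
    rw [← Matrix.trace_transpose, Matrix.transpose_mul, Matrix.transpose_transpose]
  have hUU : (Uᵀ * U).trace = d := by rw [hU]; simp
  have e1 : (((1 + σ ^ 2) • M - U)ᵀ * ((1 + σ ^ 2) • M - U)).trace
      = (1 + σ ^ 2) ^ 2 * (Mᵀ * M).trace - 2 * (1 + σ ^ 2) * (Mᵀ * U).trace + d := by
    rw [Matrix.transpose_sub, Matrix.transpose_smul, Matrix.sub_mul, Matrix.mul_sub,
      Matrix.mul_sub, Matrix.trace_sub, Matrix.trace_sub, Matrix.trace_sub]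
    simp only [Matrix.smul_mul, Matrix.mul_smul, Matrix.trace_smul, hcomm, hUU, smul_eq_mul]
    ring
  have e2 : ((M - U)ᵀ * (M - U)).trace = (Mᵀ * M).trace - 2 * (Mᵀ * U).trace + d := by
    rw [Matrix.transpose_sub, Matrix.sub_mul, Matrix.mul_sub,
      Matrix.mul_sub, Matrix.trace_sub, Matrix.trace_sub, Matrix.trace_sub, hcomm, hUU]
    ring
  rw [e1] at hsq
  rw [e2, div_le_iff₀ hs, one_div, inv_mul_eq_div, div_mul_eq_mul_div, le_div_iff₀ hd']
  nlinarith [mul_le_mul_of_nonneg_left hWU (mul_nonneg (sq_nonneg σ) hs.le)]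

/-! ### Nets of the unit ball and discretization of forms -/

section Nets

/-- The unit ball of an `m`-dimensional normed space has a `1/2`-net with at most `5 ^ m` points. -/
lemma exists_half_net (E : Type*) [NormedAddCommGroup E] [NormedSpace ℝ E]
    [FiniteDimensional ℝ E] :
    ∃ s : Finset E, s.card ≤ 5 ^ finrank ℝ E ∧ (∀ c ∈ s, ‖c‖ ≤ 1) ∧
      ∀ x : E, ‖x‖ ≤ 1 → ∃ c ∈ s, ‖x - c‖ ≤ 1 / 2 := by
  classical
  -- A 1-separated subset of the radius-2 ball has at most `5 ^ dim` points. One of maximal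
  -- cardinality is a 1-net of that ball, and halving it gives a 1/2-net of the unit ball.
  let P : ℕ → Prop := fun k => ∃ t : Finset E, t.card = k ∧ (∀ c ∈ t, ‖c‖ ≤ 2) ∧
    ∀ c ∈ t, ∀ c' ∈ t, c ≠ c' → 1 ≤ ‖c - c'‖
  have hP0 : P 0 := ⟨∅, by simp⟩
  obtain ⟨t, htk, ht2, htsep⟩ : P (Nat.findGreatest P (5 ^ finrank ℝ E)) :=
    Nat.findGreatest_spec (Nat.zero_le _) hP0
  refine ⟨t.image fun c => (1 / 2 : ℝ) • c, ?_, ?_, ?_⟩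
  · exact Finset.card_image_le.trans (Besicovitch.card_le_of_separated t ht2 htsep)
  · intro c hc
    obtain ⟨c', hc', rfl⟩ := Finset.mem_image.1 hc
    rw [norm_smul, Real.norm_of_nonneg (by norm_num)]
    linarith [ht2 c' hc']
  · intro x hx
    by_contra! hcon
    have hfar : ∀ c ∈ t, 1 ≤ ‖(2 : ℝ) • x - c‖ := fun c hc => by
      have h1 := hcon _ (Finset.mem_image_of_mem _ hc)
      have h2 : (2 : ℝ) • x - c = (2 : ℝ) • (x - (1 / 2 : ℝ) • c) := by
        rw [smul_sub, smul_smul]; norm_num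
      rw [h2, norm_smul, Real.norm_of_nonneg (by norm_num)]
      linarith
    have hnot : (2 : ℝ) • x ∉ t := fun hmem => by
      have := hfar _ hmem
      rw [sub_self, norm_zero] at this
      linarith
    have h2 : ∀ c ∈ insert ((2 : ℝ) • x) t, ‖c‖ ≤ 2 := by
      intro c hc
      rcases Finset.mem_insert.1 hc with rfl | hc
      · rw [norm_smul, Real.norm_of_nonneg (by norm_num)]; linarith
      · exact ht2 c hc
    have hsep : ∀ c ∈ insert ((2 : ℝ) • x) t, ∀ c' ∈ insert ((2 : ℝ) • x) t, c ≠ c' →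
        1 ≤ ‖c - c'‖ := by
      intro c hc c' hc' hne
      rcases Finset.mem_insert.1 hc with rfl | hc <;> rcases Finset.mem_insert.1 hc' with rfl | hc'
      · exact absurd rfl hne
      · exact hfar c' hc'
      · rw [norm_sub_rev]; exact hfar c hc
      · exact htsep c hc c' hc' hne
    have hPs : P (t.card + 1) := ⟨_, Finset.card_insert_of_notMem hnot, h2, hsep⟩
    have hle : t.card + 1 ≤ 5 ^ finrank ℝ E := by
      rw [← Finset.card_insert_of_notMem hnot]
      exact Besicovitch.card_le_of_separated _ h2 hsep
    have := Nat.le_findGreatest hle hPs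
    omega

/-- A linear functional bounded by `t` on a `1/2`-net of the unit ball has norm at most `2 t`. -/
lemma le_two_mul_norm_of_half_net {E : Type*} [NormedAddCommGroup E] [NormedSpace ℝ E]
    [FiniteDimensional ℝ E] {s : Finset E}
    (hs : ∀ x : E, ‖x‖ ≤ 1 → ∃ c ∈ s, ‖x - c‖ ≤ 1 / 2) (f : E →ₗ[ℝ] ℝ) {t : ℝ} (ht : 0 ≤ t)
    (h : ∀ c ∈ s, f c ≤ t) (x : E) : f x ≤ 2 * t * ‖x‖ := by
  let g := LinearMap.toContinuousLinearMap f
  have hfg : ∀ y, f y = g y := fun y => rfl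
  have hunit : ∀ y : E, ‖y‖ ≤ 1 → f y ≤ t + ‖g‖ / 2 := by
    intro y hy
    obtain ⟨c, hc, hyc⟩ := hs y hy
    have e : f y = f c + g (y - c) := by rw [← hfg, map_sub]; ring
    have := (le_abs_self _).trans (g.le_opNorm (y - c))
    nlinarith [h c hc, norm_nonneg g]
  -- The half-norm is absorbed on the left; applying `hunit` to `-y` makes the one-sided hypothesis
  -- enough.
  have hg : ‖g‖ ≤ t + ‖g‖ / 2 := by
    refine ContinuousLinearMap.opNorm_le_of_unit_norm (by positivity) fun y hy => ?_
    rw [Real.norm_eq_abs, abs_le, ← hfg]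
    have := hunit (-y) (by rw [norm_neg, hy])
    rw [map_neg] at this
    exact ⟨by linarith, hunit y hy.le⟩
  calc f x ≤ ‖g‖ * ‖x‖ := (le_abs_self _).trans (g.le_opNorm x)
    _ ≤ 2 * t * ‖x‖ := by gcongr; linarith

/-- A bilinear form bounded by `t` on `1/2`-nets of the unit balls has norm at most `4 t`. -/
lemma le_four_mul_norm_of_half_net {E F : Type*} [NormedAddCommGroup E] [NormedSpace ℝ E]
    [FiniteDimensional ℝ E] [NormedAddCommGroup F] [NormedSpace ℝ F]
    [FiniteDimensional ℝ F] {s : Finset E} {s' : Finset F}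
    (hs : ∀ x : E, ‖x‖ ≤ 1 → ∃ c ∈ s, ‖x - c‖ ≤ 1 / 2)
    (hs' : ∀ x : F, ‖x‖ ≤ 1 → ∃ c ∈ s', ‖x - c‖ ≤ 1 / 2)
    (f : E →ₗ[ℝ] F →ₗ[ℝ] ℝ) {t : ℝ} (ht : 0 ≤ t)
    (h : ∀ c ∈ s, ∀ c' ∈ s', f c c' ≤ t) (x : E) (y : F) : f x y ≤ 4 * t * (‖x‖ * ‖y‖) := by
  have h1 : ∀ c' ∈ s', f x c' ≤ 2 * t * ‖x‖ := fun c' hc' =>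
    le_two_mul_norm_of_half_net hs (f.flip c') ht (fun c hc => h c hc c' hc') x
  have := le_two_mul_norm_of_half_net hs' (f x) (by positivity) h1 y
  linarith

end Nets

/-! ### Chernoff bound and exponential moments -/

section Chernoff

/-- **Chernoff's bound** for a sum of i.i.d. variables. -/
lemma measure_pi_le_sum_le {Ω : Type*} [MeasurableSpace Ω] (μ : Measure Ω) [IsProbabilityMeasure μ]
    (N : ℕ) {f : Ω → ℝ} (hf : Measurable f) {κ : ℝ} (t : ℝ)
    (h : ∫⁻ ω, ENNReal.ofReal (Real.exp (f ω)) ∂μ ≤ ENNReal.ofReal (Real.exp κ)) :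
    Measure.pi (fun _ : Fin N => μ) {D | t ≤ ∑ k, f (D k)} ≤
      ENNReal.ofReal (Real.exp (N * κ - t)) := by
  have hmeas : Measurable fun ω => ENNReal.ofReal (Real.exp (f ω)) := by fun_prop
  have hind : iIndepFun (fun (k : Fin N) (D : Fin N → Ω) => ENNReal.ofReal (Real.exp (f (D k))))
      (Measure.pi fun _ : Fin N => μ) :=
    iIndepFun_pi (X := fun _ ω => ENNReal.ofReal (Real.exp (f ω))) fun _ => hmeas.aemeasurable
  have hint : ∫⁻ D, ∏ k, ENNReal.ofReal (Real.exp (f (D k))) ∂(Measure.pi fun _ : Fin N => μ)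
      ≤ ENNReal.ofReal (Real.exp (N * κ)) := by
    rw [lintegral_prod_eq_prod_lintegral_of_indepFun Finset.univ _ hind
      (fun k => hmeas.comp (measurable_pi_apply k))]
    have e : ∀ k : Fin N, ∫⁻ D, ENNReal.ofReal (Real.exp (f (D k)))
        ∂(Measure.pi fun _ : Fin N => μ) = ∫⁻ ω, ENNReal.ofReal (Real.exp (f ω)) ∂μ := fun k =>
      (measurePreserving_eval (fun _ : Fin N => μ) k).lintegral_comp hmeas
    simp_rw [e]
    rw [Finset.prod_const, Finset.card_univ, Fintype.card_fin, Real.exp_nat_mul,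
      ENNReal.ofReal_pow (Real.exp_pos _).le]
    gcongr
  have hprod : ∀ D : Fin N → Ω, ∏ k, ENNReal.ofReal (Real.exp (f (D k)))
      = ENNReal.ofReal (Real.exp (∑ k, f (D k))) := fun D => by
    rw [Real.exp_sum, ENNReal.ofReal_prod_of_nonneg fun _ _ => (Real.exp_pos _).le]
  simp_rw [hprod] at hint
  have hsub : {D : Fin N → Ω | t ≤ ∑ k, f (D k)} ⊆
      {D | ENNReal.ofReal (Real.exp t) ≤ ENNReal.ofReal (Real.exp (∑ k, f (D k)))} :=
    fun D hD => ENNReal.ofReal_le_ofReal (Real.exp_le_exp.2 hD)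
  refine (measure_mono hsub).trans ((meas_ge_le_lintegral_div
    (Measurable.aemeasurable (by fun_prop)) ?_ ?_).trans ?_)
  · simp [Real.exp_pos]
  · simp
  · rw [Real.exp_sub, ENNReal.ofReal_div_of_pos (Real.exp_pos _)]
    gcongr

lemma lintegral_exp_mul_gaussianReal (v : ℝ≥0) (t : ℝ) :
    ∫⁻ x, ENNReal.ofReal (Real.exp (t * x)) ∂(gaussianReal 0 v) =
      ENNReal.ofReal (Real.exp (v * t ^ 2 / 2)) := by
  rw [← ofReal_integral_eq_lintegral_ofReal (integrable_exp_mul_gaussianReal t)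
    (Filter.Eventually.of_forall fun x => (Real.exp_pos _).le)]
  have := congrFun (mgf_fun_id_gaussianReal (μ := 0) (v := v)) t
  simp only [mgf, zero_mul, zero_add] at this
  rw [this]

/-- The exponential moments of a centered squared Gaussian variable. -/
lemma lintegral_exp_sq_sub_gaussianReal_le {v θ : ℝ} (hv : 0 ≤ v) (hθ : |θ| * v ≤ 1 / 4) :
    ∫⁻ x, ENNReal.ofReal (Real.exp (θ * (x ^ 2 - v))) ∂(gaussianReal 0 v.toNNReal) ≤
      ENNReal.ofReal (Real.exp (4 * θ ^ 2 * v ^ 2)) := by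
  rcases hv.eq_or_lt with rfl | hv'
  · simp
  have hvne : v.toNNReal ≠ 0 := by simpa using hv'
  have hθv : |θ * v| ≤ 1 / 4 := by rwa [abs_mul, abs_of_pos hv']
  obtain ⟨hlo, hhi⟩ := abs_le.1 hθv
  -- The coefficient left after merging `θ x²` with the Gaussian density. The integral is then
  -- exactly `e^{-θv} (1 - 2θv)^{-1/2}`.
  set b := 1 / (2 * v) - θ with hb
  have hbv : b = (1 - 2 * (θ * v)) / (2 * v) := by rw [hb]; field_simp
  have hb0 : 0 < b := by rw [hbv]; apply div_pos <;> linarith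
  rw [gaussianReal_of_var_ne_zero _ hvne,
    lintegral_withDensity_eq_lintegral_mul _ (measurable_gaussianPDF _ _) (by fun_prop)]
  have hpt : ∀ x : ℝ, (gaussianPDF 0 v.toNNReal * fun x => ENNReal.ofReal
      (Real.exp (θ * (x ^ 2 - v)))) x = ENNReal.ofReal
        ((√(2 * Real.pi * v))⁻¹ * Real.exp (-(θ * v)) * Real.exp (-b * x ^ 2)) := by
    intro x
    rw [Pi.mul_apply, gaussianPDF, ← ENNReal.ofReal_mul (gaussianPDFReal_nonneg _ _ _),
      gaussianPDFReal, Real.coe_toNNReal _ hv, mul_assoc (√(2 * Real.pi * v))⁻¹,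
      mul_assoc (√(2 * Real.pi * v))⁻¹, ← Real.exp_add, ← Real.exp_add]
    congr 3
    rw [hb]; field_simp; ring
  simp_rw [hpt]
  rw [← ofReal_integral_eq_lintegral_ofReal ((integrable_exp_neg_mul_sq hb0).const_mul _)
    (Filter.Eventually.of_forall fun x => by positivity), integral_const_mul, integral_gaussian]
  refine ENNReal.ofReal_le_ofReal ?_
  set y := 2 * (θ * v) with hy
  have hy1 : 0 < 1 - y := by linarith
  have hsqrt : (√(2 * Real.pi * v))⁻¹ * √(Real.pi / b) = (√(1 - y))⁻¹ := by
    rw [← Real.sqrt_inv, ← Real.sqrt_mul (by positivity), ← Real.sqrt_inv, hbv]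
    congr 1
    field_simp
  -- The linear term cancels the centering `e^{-θv}`; half the quadratic term is `y² = 4θ²v²`.
  have hlog : -Real.log (1 - y) ≤ y + 2 * y ^ 2 := by
    have hyabs : |y| ≤ 1 / 2 := abs_le.2 ⟨by linarith, by linarith⟩
    have h1 := Real.abs_log_sub_add_sum_range_le (x := y) (by linarith) 1
    simp only [Finset.range_one, Finset.sum_singleton, zero_add, pow_one, Nat.cast_zero,
      div_one] at h1
    have h2 : |y| ^ (1 + 1) / (1 - |y|) ≤ 2 * y ^ 2 := by
      rw [div_le_iff₀ (by linarith), show (1 + 1 : ℕ) = 2 from rfl, sq_abs]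
      nlinarith [sq_nonneg y]
    have := (abs_le.1 (h1.trans h2)).1
    linarith
  have hsq : (√(1 - y))⁻¹ = Real.exp (-Real.log (1 - y) / 2) := by
    rw [Real.sqrt_eq_rpow, ← Real.rpow_neg hy1.le, Real.rpow_def_of_pos hy1]
    congr 1; ring
  rw [mul_right_comm, hsqrt, hsq, ← Real.exp_add, Real.exp_le_exp]
  nlinarith

/-- The self-normalized exponential moment of a product `a b` with `b` Gaussian and independent
of `a`. -/
lemma lintegral_exp_mul_sub_le_one {Ω : Type*} [MeasurableSpace Ω] {μ : Measure Ω}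
    [IsProbabilityMeasure μ] {a b : Ω → ℝ} (ha : Measurable a) (hb : Measurable b)
    (hab : IndepFun a b μ) {v τ : ℝ} (hv : 0 ≤ v) (hlaw : μ.map b = gaussianReal 0 v.toNNReal)
    (hvτ : v ≤ τ) (s : ℝ) :
    ∫⁻ ω, ENNReal.ofReal (Real.exp (s * (a ω * b ω) - s ^ 2 * τ / 2 * a ω ^ 2)) ∂μ ≤ 1 := by
  have := Measure.isProbabilityMeasure_map (μ := μ) ha.aemeasurable
  have hF : Measurable fun p : ℝ × ℝ =>
      ENNReal.ofReal (Real.exp (s * (p.1 * p.2) - s ^ 2 * τ / 2 * p.1 ^ 2)) := by fun_prop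
  have e := lintegral_map (μ := μ) hF (ha.prodMk hb)
  rw [(indepFun_iff_map_prod_eq_prod_map_map ha.aemeasurable hb.aemeasurable).1 hab, hlaw,
    lintegral_prod _ hF.aemeasurable] at e
  rw [← e]
  -- With the first factor fixed at `x`, the Gaussian moment is `exp(s²x²v/2)`, which the
  -- compensator dominates since `v ≤ τ`.
  have hinner : ∀ x : ℝ, ∫⁻ y, ENNReal.ofReal (Real.exp (s * (x * y) - s ^ 2 * τ / 2 * x ^ 2))
      ∂(gaussianReal 0 v.toNNReal) ≤ 1 := by
    intro x
    have hpt : ∀ y : ℝ, ENNReal.ofReal (Real.exp (s * (x * y) - s ^ 2 * τ / 2 * x ^ 2))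
        = ENNReal.ofReal (Real.exp (-(s ^ 2 * τ / 2 * x ^ 2))) *
          ENNReal.ofReal (Real.exp (s * x * y)) := fun y => by
      rw [← ENNReal.ofReal_mul (Real.exp_pos _).le, ← Real.exp_add]
      congr 2; ring
    simp_rw [hpt]
    rw [lintegral_const_mul _ (by fun_prop), lintegral_exp_mul_gaussianReal,
      ← ENNReal.ofReal_mul (Real.exp_pos _).le, ← Real.exp_add, Real.coe_toNNReal _ hv]
    refine ENNReal.ofReal_le_one.2 (Real.exp_le_one_iff.2 ?_)
    nlinarith [mul_le_mul_of_nonneg_right hvτ (sq_nonneg (s * x))]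
  calc _ ≤ ∫⁻ _, 1 ∂(μ.map a) := lintegral_mono hinner
    _ = 1 := by simp

end Chernoff

/-! ### Uniform concentration of empirical covariances -/

section Concentration

variable {Ω : Type*} [MeasurableSpace Ω] {μ : Measure Ω} [IsProbabilityMeasure μ]
  {E F : Type*} [NormedAddCommGroup E] [NormedSpace ℝ E] [FiniteDimensional ℝ E]
  [NormedAddCommGroup F] [NormedSpace ℝ F] [FiniteDimensional ℝ F]

/-- Tail bound for the empirical second moment of a centered Gaussian variable. -/
lemma measure_pi_empirical_variance_le {X : Ω → ℝ} (hX : Measurable X) {v τ : ℝ} (hv : 0 ≤ v)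
    (hlaw : μ.map X = gaussianReal 0 v.toNNReal) (hτ : 0 < τ) (hvτ : v ≤ 4 * τ) (N : ℕ) :
    Measure.pi (fun _ : Fin N => μ) {D | (N : ℝ) / 8 ≤ |∑ k, (X (D k) ^ 2 - v)|} ≤
      2 * ENNReal.ofReal (Real.exp (-(N / (16384 * (τ * (1 + τ)))))) := by
  -- The factor `τ(1 + τ)` makes both `θτ` and `θτ²` small: the first keeps the exponential moment
  -- finite, the second gives a log-moment of at most `θ/16` per sample. The exponent is then `Nθ/16
  -- - Nθ/8 = -Nθ/16`, whence 16384.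
  set θ := 1 / (1024 * (τ * (1 + τ))) with hθ
  have hθ0 : 0 < θ := by positivity
  have hθτ : θ * τ ≤ 1 / 1024 := by
    rw [hθ, div_mul_eq_mul_div, div_le_div_iff₀ (by positivity) (by norm_num)]
    nlinarith
  have hθτ2 : θ * τ ^ 2 ≤ 1 / 1024 := by
    rw [hθ, div_mul_eq_mul_div, div_le_div_iff₀ (by positivity) (by norm_num)]
    nlinarith
  have hv2 : v ^ 2 ≤ 16 * τ ^ 2 := by nlinarith
  have hside : ∀ ε : ℝ, |ε| = 1 →
      Measure.pi (fun _ : Fin N => μ) {D | θ * (N / 8) ≤ ∑ k, ε * θ * (X (D k) ^ 2 - v)} ≤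
        ENNReal.ofReal (Real.exp (-(N / (16384 * (τ * (1 + τ)))))) := by
    intro ε hε
    have habs : |ε * θ| = θ := by rw [abs_mul, hε, abs_of_pos hθ0, one_mul]
    have hε2 : (ε * θ) ^ 2 = θ ^ 2 := by rw [← sq_abs, habs]
    refine (measure_pi_le_sum_le μ N (f := fun ω => ε * θ * (X ω ^ 2 - v))
      (κ := 4 * (ε * θ) ^ 2 * v ^ 2) (by fun_prop) _ ?_).trans ?_
    · rw [← lintegral_map (μ := μ)
        (f := fun x => ENNReal.ofReal (Real.exp (ε * θ * (x ^ 2 - v)))) (by fun_prop) hX, hlaw]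
      refine lintegral_exp_sq_sub_gaussianReal_le hv ?_
      rw [habs]
      nlinarith
    · refine ENNReal.ofReal_le_ofReal (Real.exp_le_exp.2 ?_)
      have e : (N : ℝ) / (16384 * (τ * (1 + τ))) = N * θ / 16 := by rw [hθ]; field_simp; ring
      rw [e, hε2]
      have h1 : 4 * θ ^ 2 * v ^ 2 ≤ θ / 16 := by
        have : θ * (θ * v ^ 2) ≤ θ * (1 / 64) := by
          refine mul_le_mul_of_nonneg_left ?_ hθ0.le
          nlinarith
        nlinarith
      have := mul_le_mul_of_nonneg_left h1 (Nat.cast_nonneg (α := ℝ) N)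
      nlinarith
  have hsub : {D : Fin N → Ω | (N : ℝ) / 8 ≤ |∑ k, (X (D k) ^ 2 - v)|} ⊆
      {D | θ * (N / 8) ≤ ∑ k, 1 * θ * (X (D k) ^ 2 - v)} ∪
        {D | θ * (N / 8) ≤ ∑ k, (-1) * θ * (X (D k) ^ 2 - v)} := by
    intro D hD
    simp only [Set.mem_union, Set.mem_ofPred_eq, ← Finset.mul_sum] at hD ⊢
    rcases le_abs.1 hD with h | h
    · left; nlinarith
    · right; nlinarith
  refine (measure_mono hsub).trans ((measure_union_le _ _).trans ?_)
  rw [two_mul]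
  exact add_le_add (hside 1 (by simp)) (hside (-1) (by simp))

/-- The deviation of the empirical covariance form of a linear family of random variables
from `N` times the bilinear form `q`. -/
noncomputable def covDeviation {N : ℕ} (X : E →ₗ[ℝ] Ω → ℝ) (q : E →ₗ[ℝ] E →ₗ[ℝ] ℝ)
    (D : Fin N → Ω) : E →ₗ[ℝ] E →ₗ[ℝ] ℝ :=
  LinearMap.mk₂ ℝ (fun v w => ∑ k, (X v (D k) * X w (D k) - q v w))
    (fun v v' w => by
      simp only [map_add, LinearMap.add_apply, Pi.add_apply, ← Finset.sum_add_distrib]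
      exact Finset.sum_congr rfl fun k _ => by ring)
    (fun c v w => by
      simp only [map_smul, LinearMap.smul_apply, Pi.smul_apply, smul_eq_mul, Finset.mul_sum]
      exact Finset.sum_congr rfl fun k _ => by ring)
    (fun v w w' => by
      simp only [map_add, Pi.add_apply, ← Finset.sum_add_distrib]
      exact Finset.sum_congr rfl fun k _ => by ring)
    (fun c v w => by
      simp only [map_smul, Pi.smul_apply, smul_eq_mul, Finset.mul_sum]
      exact Finset.sum_congr rfl fun k _ => by ring)

/-- **Concentration of the empirical covariance** of a finite-dimensional Gaussian family. -/
lemma measure_pi_covariance_concentration (X : E →ₗ[ℝ] Ω → ℝ) (hX : ∀ v, Measurable (X v))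
    (q : E →ₗ[ℝ] E →ₗ[ℝ] ℝ) (hsymm : ∀ v w, q v w = q w v) (hq : ∀ v, 0 ≤ q v v)
    (hlaw : ∀ v, μ.map (X v) = gaussianReal 0 (q v v).toNNReal) {τ : ℝ} (hτ : 0 < τ)
    (hqτ : ∀ v, q v v ≤ τ * ‖v‖ ^ 2) (N : ℕ) :
    Measure.pi (fun _ : Fin N => μ)
      {D | ¬ ∀ v, |∑ k, (X v (D k) ^ 2 - q v v)| ≤ N / 4 * ‖v‖ ^ 2} ≤
      ENNReal.ofReal (4 * 25 ^ finrank ℝ E * Real.exp (-(N / (16384 * (τ * (1 + τ)))))) := by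
  obtain ⟨s, hcard, hs1, hnet⟩ := exists_half_net E
  set p := ENNReal.ofReal (Real.exp (-(N / (16384 * (τ * (1 + τ)))))) with hp
  let A : E → Set (Fin N → Ω) := fun l => {D | (N : ℝ) / 8 ≤ |∑ k, (X l (D k) ^ 2 - q l l)|}
  -- The radius is 2 because polarization evaluates at `c ± c'` with `c`, `c'` in the unit ball;
  -- hence variances up to `4τ`.
  have hA : ∀ l, ‖l‖ ≤ 2 → Measure.pi (fun _ : Fin N => μ) (A l) ≤ 2 * p := fun l hl =>
    measure_pi_empirical_variance_le (hX l) (hq l) (hlaw l) hτ (by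
      have : ‖l‖ ^ 2 ≤ 4 := by nlinarith [norm_nonneg l]
      nlinarith [hqτ l]) N
  have hsub : {D : Fin N → Ω | ¬ ∀ v, |∑ k, (X v (D k) ^ 2 - q v v)| ≤ N / 4 * ‖v‖ ^ 2} ⊆
      ⋃ c ∈ s ×ˢ s, (A (c.1 + c.2) ∪ A (c.1 - c.2)) := by
    intro D hD
    by_contra hcon
    simp only [Set.mem_iUnion, Set.mem_union, Finset.mem_product, exists_prop, not_exists,
      not_and, not_or] at hcon
    refine hD fun v => ?_
    set B := covDeviation X q D with hB
    have hBv : ∀ v, B v v = ∑ k, (X v (D k) ^ 2 - q v v) := fun v => by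
      simp only [hB, covDeviation, LinearMap.mk₂_apply, sq]
    have hBs : ∀ v w, B v w = B w v := fun v w => by
      simp only [hB, covDeviation, LinearMap.mk₂_apply, hsymm v w, mul_comm]
    have hpol : ∀ v w, 4 * B v w = B (v + w) (v + w) - B (v - w) (v - w) := fun v w => by
      simp only [map_add, map_sub, LinearMap.add_apply, LinearMap.sub_apply, hBs w v]
      ring
    -- Polarization turns two deviations below `N/8` into `N/16`; passing from the net to all
    -- vectors costs a factor 4.
    have hb : ∀ c ∈ s, ∀ c' ∈ s, |B c c'| ≤ N / 16 := by
      intro c hc c' hc'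
      obtain ⟨h1, h2⟩ := hcon (c, c') ⟨hc, hc'⟩
      simp only [A, Set.mem_ofPred_eq, not_le, ← hBv] at h1 h2
      have e := hpol c c'
      have h1' := abs_lt.1 h1
      have h2' := abs_lt.1 h2
      exact abs_le.2 ⟨by linarith, by linarith⟩
    rw [← hBv, abs_le]
    have hup := le_four_mul_norm_of_half_net hnet hnet B (t := N / 16) (by positivity)
      (fun c hc c' hc' => (abs_le.1 (hb c hc c' hc')).2) v v
    have hlo := le_four_mul_norm_of_half_net hnet hnet (-B) (t := N / 16) (by positivity)
      (fun c hc c' hc' => by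
        have := (abs_le.1 (hb c hc c' hc')).1
        simp only [LinearMap.neg_apply]; linarith) v v
    simp only [LinearMap.neg_apply] at hlo
    constructor <;> nlinarith
  calc _ ≤ Measure.pi (fun _ : Fin N => μ) (⋃ c ∈ s ×ˢ s, (A (c.1 + c.2) ∪ A (c.1 - c.2))) :=
        measure_mono hsub
    _ ≤ ∑ c ∈ s ×ˢ s, 4 * p := by
        refine (measure_biUnion_finset_le _ _).trans (Finset.sum_le_sum fun c hc => ?_)
        have h1 := hs1 _ (Finset.mem_product.1 hc).1
        have h2 := hs1 _ (Finset.mem_product.1 hc).2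
        refine (measure_union_le _ _).trans ?_
        calc _ ≤ 2 * p + 2 * p := add_le_add
              (hA _ ((norm_add_le _ _).trans (by linarith)))
              (hA _ ((norm_sub_le _ _).trans (by linarith)))
          _ = 4 * p := by rw [← add_mul]; norm_num
    _ ≤ _ := by
        rw [Finset.sum_const, nsmul_eq_mul, Finset.card_product]
        have hc : ((s.card * s.card : ℕ) : ENNReal) ≤ ENNReal.ofReal (25 ^ finrank ℝ E) := by
          rw [← ENNReal.ofReal_natCast]
          refine ENNReal.ofReal_le_ofReal ?_
          have h25 : (25 : ℝ) ^ finrank ℝ E = 5 ^ finrank ℝ E * 5 ^ finrank ℝ E := by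
            rw [← mul_pow]; norm_num
          have : (s.card : ℝ) ≤ 5 ^ finrank ℝ E := by exact_mod_cast hcard
          push_cast
          rw [h25]
          gcongr
        rw [mul_comm (4 : ℝ), mul_assoc, ENNReal.ofReal_mul (by positivity),
          ENNReal.ofReal_mul (by norm_num), ← hp]
        gcongr
        simp

/-- The empirical cross-covariance form of two linear families of random variables. -/
noncomputable def crossCov {N : ℕ} (X : E →ₗ[ℝ] Ω → ℝ) (Z : F →ₗ[ℝ] Ω → ℝ)
    (D : Fin N → Ω) : E →ₗ[ℝ] F →ₗ[ℝ] ℝ :=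
  LinearMap.mk₂ ℝ (fun v w => ∑ k, X v (D k) * Z w (D k))
    (fun v v' w => by
      simp only [map_add, Pi.add_apply, ← Finset.sum_add_distrib]
      exact Finset.sum_congr rfl fun k _ => by ring)
    (fun c v w => by
      simp only [map_smul, Pi.smul_apply, smul_eq_mul, Finset.mul_sum]
      exact Finset.sum_congr rfl fun k _ => by ring)
    (fun v w w' => by
      simp only [map_add, Pi.add_apply, ← Finset.sum_add_distrib]
      exact Finset.sum_congr rfl fun k _ => by ring)
    (fun c v w => by
      simp only [map_smul, Pi.smul_apply, smul_eq_mul, Finset.mul_sum]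
      exact Finset.sum_congr rfl fun k _ => by ring)

/-- **Concentration of the empirical cross-covariance** of two independent families, the second of
which is Gaussian, on the event that the empirical second moments of the first are under
control. -/
lemma measure_pi_cross_covariance_concentration (X : E →ₗ[ℝ] Ω → ℝ) (hX : ∀ v, Measurable (X v))
    (Z : F →ₗ[ℝ] Ω → ℝ) (hZ : ∀ w, Measurable (Z w)) (hind : ∀ v w, IndepFun (X v) (Z w) μ)
    (q : F → ℝ) (hq : ∀ w, 0 ≤ q w) (hlaw : ∀ w, μ.map (Z w) = gaussianReal 0 (q w).toNNReal)
    {τ : ℝ} (hτ : 0 < τ) (hqτ : ∀ w, q w ≤ τ * ‖w‖ ^ 2) (N : ℕ) {a u : ℝ} (ha : 0 < a)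
    (hu : 0 < u) :
    Measure.pi (fun _ : Fin N => μ)
      {D | (∀ v, ∑ k, X v (D k) ^ 2 ≤ 2 * a * ‖v‖ ^ 2) ∧
        ¬ ∀ v w, ∑ k, X v (D k) * Z w (D k) ≤ 8 * √(u * (τ * a)) * (‖v‖ * ‖w‖)} ≤
      ENNReal.ofReal (5 ^ finrank ℝ E * 5 ^ finrank ℝ F * Real.exp (-u)) := by
  obtain ⟨s, hcard, hs1, hnet⟩ := exists_half_net E
  obtain ⟨s', hcard', hs1', hnet'⟩ := exists_half_net F
  set r := √(u * (τ * a)) with hr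
  have hr0 : 0 < r := Real.sqrt_pos.2 (by positivity)
  have hr2 : r ^ 2 = u * (τ * a) := Real.sq_sqrt (by positivity)
  -- This choice balances the two costs: on the second-moment event the compensator is at most `θ²τa
  -- = u`, equal to the deviation level. Hence `θ ∑ XZ ≤ 2u = 2θr`, and the nets turn `2r` into
  -- `8r`.
  set θ := u / r with hθ
  have hθ0 : 0 < θ := by positivity
  have hθr : θ * r = u := by rw [hθ]; field_simp
  have hθτ : θ * (τ * a) = r := by
    rw [hθ, div_mul_eq_mul_div, ← hr2]; field_simp
  let A : E → F → Set (Fin N → Ω) := fun v w =>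
    {D | u ≤ ∑ k, (θ * (X v (D k) * Z w (D k)) - θ ^ 2 * τ / 2 * X v (D k) ^ 2)}
  have hA : ∀ v w, ‖w‖ ≤ 1 → Measure.pi (fun _ : Fin N => μ) (A v w) ≤
      ENNReal.ofReal (Real.exp (-u)) := fun v w hw => by
    have hvX := hX v
    have hwZ := hZ w
    refine (measure_pi_le_sum_le μ N (κ := 0)
      (f := fun ω => θ * (X v ω * Z w ω) - θ ^ 2 * τ / 2 * X v ω ^ 2) (by fun_prop) u ?_).trans ?_
    · rw [Real.exp_zero, ENNReal.ofReal_one]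
      refine lintegral_exp_mul_sub_le_one hvX hwZ (hind v w) (hq w) (hlaw w) ?_ θ
      have : ‖w‖ ^ 2 ≤ 1 := pow_le_one₀ (norm_nonneg w) hw
      nlinarith [hqτ w]
    · simp
  have hsub : {D : Fin N → Ω | (∀ v, ∑ k, X v (D k) ^ 2 ≤ 2 * a * ‖v‖ ^ 2) ∧
        ¬ ∀ v w, ∑ k, X v (D k) * Z w (D k) ≤ 8 * r * (‖v‖ * ‖w‖)} ⊆
      ⋃ c ∈ s ×ˢ s', A c.1 c.2 := by
    rintro D ⟨hD1, hD⟩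
    by_contra hcon
    simp only [Set.mem_iUnion, Finset.mem_product, exists_prop, not_exists, not_and] at hcon
    refine hD fun v w => ?_
    have hb : ∀ c ∈ s, ∀ c' ∈ s', crossCov X Z D c c' ≤ 2 * r := by
      intro c hc c' hc'
      have h1 := hcon (c, c') ⟨hc, hc'⟩
      simp only [A, Set.mem_ofPred_eq, not_le, Finset.sum_sub_distrib, ← Finset.mul_sum] at h1
      have h2 : ∑ k, X c (D k) ^ 2 ≤ 2 * a := by
        have : ‖c‖ ^ 2 ≤ 1 := pow_le_one₀ (norm_nonneg c) (hs1 c hc)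
        nlinarith [hD1 c]
      change ∑ k, X c (D k) * Z c' (D k) ≤ 2 * r
      have h3 : θ ^ 2 * τ / 2 * ∑ k, X c (D k) ^ 2 ≤ u := by
        calc θ ^ 2 * τ / 2 * ∑ k, X c (D k) ^ 2 ≤ θ ^ 2 * τ / 2 * (2 * a) := by gcongr
          _ = θ * (θ * (τ * a)) := by ring
          _ = u := by rw [hθτ, hθr]
      refine le_of_mul_le_mul_left ?_ hθ0
      linarith
    have := le_four_mul_norm_of_half_net hnet hnet' (crossCov X Z D) (t := 2 * r) (by positivity)
      hb v w
    change ∑ k, X v (D k) * Z w (D k) ≤ _ at this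
    linarith
  calc _ ≤ Measure.pi (fun _ : Fin N => μ) (⋃ c ∈ s ×ˢ s', A c.1 c.2) := measure_mono hsub
    _ ≤ ∑ c ∈ s ×ˢ s', ENNReal.ofReal (Real.exp (-u)) :=
        (measure_biUnion_finset_le _ _).trans (Finset.sum_le_sum fun c hc =>
          hA _ _ (hs1' _ (Finset.mem_product.1 hc).2))
    _ ≤ _ := by
        rw [Finset.sum_const, nsmul_eq_mul, Finset.card_product, ← ENNReal.ofReal_natCast,
          ← ENNReal.ofReal_mul (by positivity)]
        refine ENNReal.ofReal_le_ofReal ?_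
        push_cast
        gcongr
        · exact_mod_cast hcard
        · exact_mod_cast hcard'

end Concentration

/-! ### Observations along the signal subspace and across it -/

section Observations

variable {n d : ℕ}

lemma inner_toEuclideanLin_left (U : Matrix (Fin n) (Fin d) ℝ) (v : EuclideanSpace ℝ (Fin d))
    (w : EuclideanSpace ℝ (Fin n)) :
    ⟪U.toEuclideanLin v, w⟫ = ⟪v, Uᵀ.toEuclideanLin w⟫ := by
  rw [← Matrix.conjTranspose_eq_transpose_of_trivial,
    Matrix.toEuclideanLin_conjTranspose_eq_adjoint, LinearMap.adjoint_inner_right]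

lemma toEuclideanLin_transpose_apply_self {U : Matrix (Fin n) (Fin d) ℝ} (hU : Uᵀ * U = 1)
    (v : EuclideanSpace ℝ (Fin d)) : Uᵀ.toEuclideanLin (U.toEuclideanLin v) = v := by
  ext i
  simp [Matrix.toLpLin_apply, Matrix.mulVec_mulVec, hU]

lemma norm_sq_toEuclideanLin {U : Matrix (Fin n) (Fin d) ℝ} (hU : Uᵀ * U = 1)
    (v : EuclideanSpace ℝ (Fin d)) : ‖U.toEuclideanLin v‖ ^ 2 = ‖v‖ ^ 2 := by
  rw [← real_inner_self_eq_norm_sq, inner_toEuclideanLin_left,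
    toEuclideanLin_transpose_apply_self hU, real_inner_self_eq_norm_sq]

/-- The orthogonal projection onto the complement of the range of `U`. -/
noncomputable def complProj (U : Matrix (Fin n) (Fin d) ℝ) :
    EuclideanSpace ℝ (Fin n) →ₗ[ℝ] EuclideanSpace ℝ (Fin n) :=
  LinearMap.id - U.toEuclideanLin ∘ₗ Uᵀ.toEuclideanLin

lemma transpose_complProj {U : Matrix (Fin n) (Fin d) ℝ} (hU : Uᵀ * U = 1)
    (w : EuclideanSpace ℝ (Fin n)) : Uᵀ.toEuclideanLin (complProj U w) = 0 := by
  simp only [complProj, LinearMap.sub_apply, LinearMap.id_apply, LinearMap.comp_apply, map_sub,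
    toEuclideanLin_transpose_apply_self hU, sub_self]

lemma complProj_eq_self {U : Matrix (Fin n) (Fin d) ℝ} {w : EuclideanSpace ℝ (Fin n)}
    (hw : Uᵀ.toEuclideanLin w = 0) : complProj U w = w := by
  simp [complProj, hw]

lemma norm_sq_complProj_le {U : Matrix (Fin n) (Fin d) ℝ} (hU : Uᵀ * U = 1)
    (w : EuclideanSpace ℝ (Fin n)) : ‖complProj U w‖ ^ 2 ≤ ‖w‖ ^ 2 := by
  have e : complProj U w = w - U.toEuclideanLin (Uᵀ.toEuclideanLin w) := rfl
  rw [e, norm_sub_sq_real, norm_sq_toEuclideanLin hU, real_inner_comm, inner_toEuclideanLin_left,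
    real_inner_self_eq_norm_sq]
  nlinarith [sq_nonneg ‖Uᵀ.toEuclideanLin w‖]

/-- The linear family of scalar observations `l ↦ ⟪l, y⟫`. -/
noncomputable def obsEval (n : ℕ) : EuclideanSpace ℝ (Fin n) →ₗ[ℝ]
    (EuclideanSpace ℝ (Fin n) × EuclideanSpace ℝ (Fin n)) → ℝ where
  toFun l ω := ⟪l, ω.2⟫
  map_add' l l' := by ext ω; exact inner_add_left _ _ _
  map_smul' c l := by ext ω; exact real_inner_smul_left _ _ _

lemma obsEval_apply (l : EuclideanSpace ℝ (Fin n))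
    (ω : EuclideanSpace ℝ (Fin n) × EuclideanSpace ℝ (Fin n)) : obsEval n l ω = ⟪l, ω.2⟫ := rfl

lemma measurable_obsEval (l : EuclideanSpace ℝ (Fin n)) : Measurable (obsEval n l) := by
  change Measurable fun ω : EuclideanSpace ℝ (Fin n) × EuclideanSpace ℝ (Fin n) => ⟪l, ω.2⟫
  fun_prop

/-- The covariance form `l, l' ↦ lᵀ (U Uᵀ + σ² I) l'` of the observations. -/
noncomputable def obsCov (U : Matrix (Fin n) (Fin d) ℝ) (σ : ℝ) :
    EuclideanSpace ℝ (Fin n) →ₗ[ℝ] EuclideanSpace ℝ (Fin n) →ₗ[ℝ] ℝ :=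
  (innerₗ (EuclideanSpace ℝ (Fin d))).compl₁₂ Uᵀ.toEuclideanLin Uᵀ.toEuclideanLin +
    σ ^ 2 • innerₗ (EuclideanSpace ℝ (Fin n))

lemma obsCov_apply (U : Matrix (Fin n) (Fin d) ℝ) (σ : ℝ) (l l' : EuclideanSpace ℝ (Fin n)) :
    obsCov U σ l l' = ⟪Uᵀ.toEuclideanLin l, Uᵀ.toEuclideanLin l'⟫ + σ ^ 2 * ⟪l, l'⟫ := rfl

lemma obsCov_self (U : Matrix (Fin n) (Fin d) ℝ) (σ : ℝ) (l : EuclideanSpace ℝ (Fin n)) :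
    obsCov U σ l l = ‖Uᵀ.toEuclideanLin l‖ ^ 2 + σ ^ 2 * ‖l‖ ^ 2 := by
  rw [obsCov_apply, real_inner_self_eq_norm_sq, real_inner_self_eq_norm_sq]

lemma obsCov_symm (U : Matrix (Fin n) (Fin d) ℝ) (σ : ℝ) (l l' : EuclideanSpace ℝ (Fin n)) :
    obsCov U σ l l' = obsCov U σ l' l := by
  rw [obsCov_apply, obsCov_apply, real_inner_comm l, real_inner_comm (Uᵀ.toEuclideanLin l)]

lemma obsEval_signal_observation (U : Matrix (Fin n) (Fin d) ℝ) (l : EuclideanSpace ℝ (Fin n))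
    (p : EuclideanSpace ℝ (Fin d) × EuclideanSpace ℝ (Fin n)) :
    obsEval n l (U.toEuclideanLin p.1, U.toEuclideanLin p.1 + p.2) =
      ⟪Uᵀ.toEuclideanLin l, p.1⟫ + ⟪l, p.2⟫ := by
  rw [obsEval_apply, inner_add_right, real_inner_comm, inner_toEuclideanLin_left, real_inner_comm]

lemma map_obsEval_jointLaw (U : Matrix (Fin n) (Fin d) ℝ) (σ : ℝ)
    (l : EuclideanSpace ℝ (Fin n)) :
    (jointLaw U σ).map (obsEval n l) = gaussianReal 0 (obsCov U σ l l).toNNReal := by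
  rw [jointLaw_eq_map, Measure.map_map (measurable_obsEval l) (measurable_signal_observation U),
    obsCov_self, ← map_inner_add_inner_sourceLaw]
  congr 1
  ext p
  exact obsEval_signal_observation U l p

/-- Observations along the signal subspace are independent of observations orthogonal to it. -/
lemma indepFun_obsEval (U : Matrix (Fin n) (Fin d) ℝ) (σ : ℝ) {l l' : EuclideanSpace ℝ (Fin n)}
    (hl' : Uᵀ.toEuclideanLin l' = 0) (hll' : ⟪l, l'⟫ = 0) :
    IndepFun (obsEval n l) (obsEval n l') (jointLaw U σ) := by
  rw [jointLaw_eq_map]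
  set g := fun p : EuclideanSpace ℝ (Fin d) × EuclideanSpace ℝ (Fin n) =>
    (U.toEuclideanLin p.1, U.toEuclideanLin p.1 + p.2) with hg
  have hgm : Measurable g := measurable_signal_observation U
  suffices h : IndepFun (obsEval n l ∘ g) (obsEval n l' ∘ g) (sourceLaw n d σ) by
    rw [indepFun_iff_map_prod_eq_prod_map_map (measurable_obsEval l).aemeasurable
      (measurable_obsEval l').aemeasurable, Measure.map_map (measurable_obsEval l) hgm,
      Measure.map_map (measurable_obsEval l') hgm,
      Measure.map_map ((measurable_obsEval l).prodMk (measurable_obsEval l')) hgm]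
    exact (indepFun_iff_map_prod_eq_prod_map_map ((measurable_obsEval l).comp hgm).aemeasurable
      ((measurable_obsEval l').comp hgm).aemeasurable).1 h
  let p₀ := Uᵀ.toEuclideanLin l
  let A : EuclideanSpace ℝ (Fin d) × EuclideanSpace ℝ (Fin n) →L[ℝ] ℝ :=
    (innerSL ℝ p₀).comp (ContinuousLinearMap.fst ℝ _ _) +
      (innerSL ℝ l).comp (ContinuousLinearMap.snd ℝ _ _)
  let B : EuclideanSpace ℝ (Fin d) × EuclideanSpace ℝ (Fin n) →L[ℝ] ℝ :=
    (innerSL ℝ l').comp (ContinuousLinearMap.snd ℝ _ _)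
  have hA : obsEval n l ∘ g = A := by
    ext p; exact obsEval_signal_observation U l p
  have hB : obsEval n l' ∘ g = B := by
    ext p
    change obsEval n l' _ = ⟪l', p.2⟫
    rw [obsEval_signal_observation, hl', inner_zero_left, zero_add]
  rw [hA, hB]
  have hid : HasGaussianLaw (fun p => p) (sourceLaw n d σ) := ⟨by
    rw [Measure.map_id']; infer_instance⟩
  -- Both observations are linear in one Gaussian vector, so vanishing covariance suffices. As `Uᵀl'
  -- = 0`, the second sees only the noise: it is uncorrelated with `c` by independence, and with
  -- `⟪l, z⟫` by orthogonality.
  refine HasGaussianLaw.indepFun_of_covariance_eq_zero (hid.map (A.prod B)) ?_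
  have hA2 : (A : EuclideanSpace ℝ (Fin d) × EuclideanSpace ℝ (Fin n) → ℝ)
      = (fun p => ⟪p₀, p.1⟫) + fun p => ⟪l, p.2⟫ := rfl
  have hB2 : (B : EuclideanSpace ℝ (Fin d) × EuclideanSpace ℝ (Fin n) → ℝ)
      = fun p => ⟪l', p.2⟫ := rfl
  have hmem : ∀ L : EuclideanSpace ℝ (Fin d) × EuclideanSpace ℝ (Fin n) →L[ℝ] ℝ,
      MemLp L 2 (sourceLaw n d σ) := fun L => (hid.map L).memLp_two
  have m1 : MemLp (fun p => ⟪p₀, p.1⟫) 2 (sourceLaw n d σ) :=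
    hmem ((innerSL ℝ p₀).comp (ContinuousLinearMap.fst ℝ _ _))
  have m2 : MemLp (fun p => ⟪l, p.2⟫) 2 (sourceLaw n d σ) :=
    hmem ((innerSL ℝ l).comp (ContinuousLinearMap.snd ℝ _ _))
  have m3 : MemLp (fun p => ⟪l', p.2⟫) 2 (sourceLaw n d σ) := hmem B
  rw [hA2, hB2, covariance_add_left m1 m2 m3]
  have c1 : cov[fun p => ⟪p₀, p.1⟫, fun p => ⟪l', p.2⟫; sourceLaw n d σ] = 0 := by
    refine IndepFun.covariance_eq_zero ?_ m1 m3
    unfold sourceLaw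
    exact indepFun_prod (X := fun x => ⟪p₀, x⟫) (Y := fun x => ⟪l', x⟫) (by fun_prop)
      (by fun_prop)
  have c2 : cov[fun p => ⟪l, p.2⟫, fun p => ⟪l', p.2⟫; sourceLaw n d σ] = 0 := by
    have hsnd : (sourceLaw n d σ).map Prod.snd = multivariateGaussian
        (0 : EuclideanSpace ℝ (Fin n)) (σ ^ 2 • (1 : Matrix (Fin n) (Fin n) ℝ)) :=
      Measure.snd_prod
    have h := covariance_map (μ := sourceLaw n d σ) (Z := Prod.snd)
      (X := fun x : EuclideanSpace ℝ (Fin n) => ⟪l, x⟫) (Y := fun x => ⟪l', x⟫)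
      (Measurable.aestronglyMeasurable (by fun_prop))
      (Measurable.aestronglyMeasurable (by fun_prop)) (by fun_prop)
    refine h.symm.trans ?_
    rw [hsnd, ← covarianceBilin_apply_eq_cov IsGaussian.memLp_two_id,
      covarianceBilin_multivariateGaussian (posSemidef_sq_smul_one n σ), Matrix.smul_mulVec,
      Matrix.one_mulVec, dotProduct_smul]
    have : l.ofLp ⬝ᵥ l'.ofLp = 0 := by
      rw [← hll', PiLp.inner_apply]; simp [dotProduct, mul_comm]
    rw [this, smul_zero]
  rw [c1, c2, add_zero]

end Observations

/-! ### The good event and subspace recovery -/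

section GoodEvent

variable {n d N : ℕ}

/-- The bridge from the matrix perturbation bound to the empirical sums controlled by concentration.
-/
lemma dotProduct_gram_mulVec (D : Fin N → EuclideanSpace ℝ (Fin n) × EuclideanSpace ℝ (Fin n))
    (a b : Fin n → ℝ) :
    a ⬝ᵥ (obsMatrix D * (obsMatrix D)ᵀ) *ᵥ b =
      ∑ k, obsEval n (WithLp.toLp 2 a) (D k) * obsEval n (WithLp.toLp 2 b) (D k) := by
  have h : ∀ c : Fin n → ℝ, (obsMatrix D)ᵀ *ᵥ c =
      fun k => obsEval n (WithLp.toLp 2 c) (D k) := fun c => by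
    ext k
    rw [obsEval_apply, PiLp.inner_apply]
    simp [Matrix.mulVec, dotProduct, obsMatrix]
  rw [← Matrix.mulVec_mulVec, Matrix.dotProduct_mulVec, ← Matrix.mulVec_transpose, h, h]
  rfl

lemma norm_toLp_sq {m : ℕ} (v : Fin m → ℝ) : ‖WithLp.toLp 2 v‖ ^ 2 = v ⬝ᵥ v := by
  rw [EuclideanSpace.real_norm_sq_eq]; simp [dotProduct, sq]

lemma norm_toLp {m : ℕ} (v : Fin m → ℝ) : ‖WithLp.toLp 2 v‖ = √(v ⬝ᵥ v) := by
  rw [← norm_toLp_sq, Real.sqrt_sq (norm_nonneg _)]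

/-- On the event that the blocks of the empirical covariance are close to the population ones, the
leading singular vectors span a subspace close to the signal subspace. -/
lemma sinTheta_le_of_covariance_bounds (hdn : d < n) (hN : 0 < N)
    {U : Matrix (Fin n) (Fin d) ℝ} (hU : Uᵀ * U = 1) {σ r : ℝ} (hr : 0 ≤ r)
    {D : Fin N → EuclideanSpace ℝ (Fin n) × EuclideanSpace ℝ (Fin n)}
    (h1 : ∀ v, |∑ k, ((obsEval n ∘ₗ U.toEuclideanLin) v (D k) ^ 2 -
      (obsCov U σ).compl₁₂ U.toEuclideanLin U.toEuclideanLin v v)| ≤ N / 4 * ‖v‖ ^ 2)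
    (h2 : ∀ w, |∑ k, ((obsEval n ∘ₗ complProj U) w (D k) ^ 2 -
      (obsCov U σ).compl₁₂ (complProj U) (complProj U) w w)| ≤ N / 4 * ‖w‖ ^ 2)
    (h3 : ∀ v w, ∑ k, (obsEval n ∘ₗ U.toEuclideanLin) v (D k) *
      (obsEval n ∘ₗ complProj U) w (D k) ≤ r * (‖v‖ * ‖w‖))
    {V : Matrix (Fin n) (Fin d) ℝ}
    (hV : IsLeadingSingularVectors hdn.le (obsMatrix D * (obsMatrix D)ᵀ) V) :
    d - ((Uᵀ * V)ᵀ * (Uᵀ * V)).trace ≤ 16 * r ^ 2 * d / N ^ 2 := by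
  set G := obsMatrix D * (obsMatrix D)ᵀ with hG
  have hN' : (0 : ℝ) < N := by exact_mod_cast hN
  have hGps : G.PosSemidef := by
    rw [hG, ← Matrix.conjTranspose_eq_transpose_of_trivial]
    exact Matrix.posSemidef_self_mul_conjTranspose _
  have hGt : Gᵀ = G := by rw [hG, Matrix.transpose_mul, Matrix.transpose_transpose]
  have hVV := hV.transpose_mul_self
  have hUlin : ∀ v : Fin d → ℝ, U.toEuclideanLin (WithLp.toLp 2 v) = WithLp.toLp 2 (U *ᵥ v) :=
    fun v => by simp [Matrix.toLpLin_apply]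
  have hw0 : ∀ w : Fin n → ℝ, Uᵀ *ᵥ w = 0 → Uᵀ.toEuclideanLin (WithLp.toLp 2 w) = 0 :=
    fun w hw => by simp [Matrix.toLpLin_apply, hw]
  -- The population blocks are `N(1 + σ²)` and `Nσ²` times the identity. Each loses at most `N/4`,
  -- leaving a gap of `N/2`.
  have key := sinTheta_bound (U := U) (V := V) hU hVV hGt (lam := N * (1 + σ ^ 2 - 1 / 4))
    (mu := N * (σ ^ 2 + 1 / 4)) (eta := r) hr (hV.trace_le hdn hGps hU) ?_ ?_ ?_
  · have hD0 : 0 ≤ (d : ℝ) - ((Uᵀ * V)ᵀ * (Uᵀ * V)).trace := by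
      have := trace_transpose_mul_le hU V
      rw [hVV] at this
      simp only [Matrix.trace_one, Fintype.card_fin] at this
      linarith
    have e : N * (1 + σ ^ 2 - 1 / 4) - N * (σ ^ 2 + 1 / 4) = (N : ℝ) / 2 := by ring
    rw [e] at key
    refine (sinTheta_bound_sq (by positivity) hD0 key).trans (le_of_eq ?_)
    field_simp
    ring
  · intro v
    have h := (abs_le.1 (h1 (WithLp.toLp 2 v))).1
    have e : v ⬝ᵥ (Uᵀ * G * U) *ᵥ v = (U *ᵥ v) ⬝ᵥ G *ᵥ (U *ᵥ v) := by
      rw [Matrix.mul_assoc, ← Matrix.mulVec_mulVec, ← Matrix.mulVec_mulVec,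
        Matrix.dotProduct_mulVec, Matrix.vecMul_transpose]
    rw [e, hG, dotProduct_gram_mulVec]
    simp only [LinearMap.comp_apply, LinearMap.compl₁₂_apply, obsCov_self,
      toEuclideanLin_transpose_apply_self hU, norm_sq_toEuclideanLin hU, Finset.sum_sub_distrib,
      Finset.sum_const, Finset.card_univ, Fintype.card_fin, nsmul_eq_mul, norm_toLp_sq,
      sq (obsEval n _ _)] at h
    simp only [hUlin] at h
    linarith
  · intro w hw
    have h := (abs_le.1 (h2 (WithLp.toLp 2 w))).2
    rw [hG, dotProduct_gram_mulVec]
    simp only [LinearMap.comp_apply, LinearMap.compl₁₂_apply, obsCov_self,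
      complProj_eq_self (hw0 w hw), hw0 w hw, Finset.sum_sub_distrib,
      Finset.sum_const, Finset.card_univ, Fintype.card_fin, nsmul_eq_mul, norm_toLp_sq,
      norm_zero, sq (obsEval n _ _)] at h
    linarith
  · intro v w hw
    have h := h3 (WithLp.toLp 2 v) (WithLp.toLp 2 w)
    rw [hG, dotProduct_gram_mulVec]
    simpa only [LinearMap.comp_apply, complProj_eq_self (hw0 w hw), hUlin, norm_toLp] using h

/-- Since `8 · 25^m ≤ 200^m ≤ e^{6m}`, the exponent `7m` pays for the union bound over pairs of net
points and leaves `e^{-m}`. -/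
lemma four_mul_pow_mul_exp_le {m : ℕ} (hm : 1 ≤ m) :
    4 * (25 : ℝ) ^ m * Real.exp (-(7 * m)) ≤ 1 / 2 * Real.exp (-m) := by
  have h6 : (200 : ℝ) ≤ Real.exp 6 := by
    have h := pow_le_pow_left₀ (by norm_num) Real.exp_one_gt_d9.le 6
    rw [← Real.exp_nat_mul] at h
    norm_num at h ⊢
    linarith
  have h8 : (8 : ℝ) ≤ 8 ^ m := le_self_pow₀ (by norm_num) (by omega)
  have h200 : 8 * (25 : ℝ) ^ m ≤ Real.exp (m * 6) := by
    calc 8 * (25 : ℝ) ^ m ≤ 8 ^ m * 25 ^ m := by gcongr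
      _ = 200 ^ m := by rw [← mul_pow]; norm_num
      _ ≤ Real.exp 6 ^ m := by gcongr
      _ = Real.exp (m * 6) := by rw [← Real.exp_nat_mul]
  have e : Real.exp (-(m : ℝ)) = Real.exp (m * 6) * Real.exp (-(7 * m)) := by
    rw [← Real.exp_add]; congr 1; ring
  rw [e]
  nlinarith [Real.exp_pos (-(7 * (m : ℝ)))]

/-- The two nets have at most `25^n ≤ e^{4n}` pairs, hence the choice `u = 5n` for the off-diagonal
block. -/
lemma pow_mul_pow_mul_exp_le (hdn : d ≤ n) :
    (5 : ℝ) ^ d * 5 ^ n * Real.exp (-(5 * n)) ≤ Real.exp (-n) := by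
  have h4 : (25 : ℝ) ≤ Real.exp 4 := by
    have h := pow_le_pow_left₀ (by norm_num) Real.exp_one_gt_d9.le 4
    rw [← Real.exp_nat_mul] at h
    norm_num at h ⊢
    linarith
  have h25 : (5 : ℝ) ^ d * 5 ^ n ≤ Real.exp (n * 4) := by
    calc (5 : ℝ) ^ d * 5 ^ n ≤ 5 ^ n * 5 ^ n := by
          gcongr; norm_num
      _ = 25 ^ n := by rw [← mul_pow]; norm_num
      _ ≤ Real.exp 4 ^ n := by gcongr
      _ = Real.exp (n * 4) := by rw [← Real.exp_nat_mul]
  have e : Real.exp (-(n : ℝ)) = Real.exp (n * 4) * Real.exp (-(5 * n)) := by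
    rw [← Real.exp_add]; congr 1; ring
  rw [e]
  gcongr

lemma exp_neg_div_le {m : ℕ} {t κ : ℝ} (hκ : 0 < κ) (h : 7 * m * κ ≤ t) :
    Real.exp (-(t / κ)) ≤ Real.exp (-(7 * m)) := by
  rw [Real.exp_le_exp, neg_le_neg_iff, le_div_iff₀ hκ]
  exact h

/-- **Subspace recovery**: for sufficiently many samples the leading singular vectors of the
empirical covariance are close to the signal subspace, outside of an event of probability at most
`2 exp (-d)`. -/
lemma trainingLaw_sinTheta_le (hd : 1 ≤ d) (hdn : d < n) {U : Matrix (Fin n) (Fin d) ℝ}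
    (hU : Uᵀ * U = 1) (σ : ℝ) (hN : 229376 * ((1 + σ ^ 2) * (d + n * σ ^ 2)) ≤ N) :
    (trainingLaw U σ N).real {D | ¬ ∀ V : Matrix (Fin n) (Fin d) ℝ,
      IsLeadingSingularVectors hdn.le (obsMatrix D * (obsMatrix D)ᵀ) V →
        d - ((Uᵀ * V)ᵀ * (Uᵀ * V)).trace ≤
          5120 * d * ((1 + σ ^ 2) * (d + n * σ ^ 2)) / N} ≤ 2 * Real.exp (-d) := by
  have hd' : (1 : ℝ) ≤ d := by exact_mod_cast hd
  have hn1 : 1 ≤ n := by omega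
  have hn' : (0 : ℝ) < n := by exact_mod_cast hn1
  have hdn' : (d : ℝ) ≤ n := by exact_mod_cast hdn.le
  have hN0' : (0 : ℝ) < N := lt_of_lt_of_le (by positivity) hN
  have hN0 : 0 < N := by exact_mod_cast hN0'
  -- The variances across the signal are at most `σ²`. Adding `d/n` keeps `τ` positive when `σ = 0`
  -- and makes `nτ` equal to `d + nσ²`.
  set τ := σ ^ 2 + d / n with hτ
  have hτ0 : 0 < τ := by positivity
  have hnτ : n * τ = d + n * σ ^ 2 := by rw [hτ]; field_simp; ring
  have hτσ : τ ≤ 1 + σ ^ 2 := by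
    have : (d : ℝ) / n ≤ 1 := (div_le_one hn').2 hdn'
    linarith
  set a := N * (1 + σ ^ 2) with ha
  have ha0 : 0 < a := by positivity
  let X := obsEval n ∘ₗ U.toEuclideanLin
  -- Indexing by all of `ℝⁿ` through the projection, instead of by the complement itself, only
  -- enlarges the net to dimension `n`.
  let Z := obsEval n ∘ₗ complProj U
  let qX := (obsCov U σ).compl₁₂ U.toEuclideanLin U.toEuclideanLin
  let qZ := (obsCov U σ).compl₁₂ (complProj U) (complProj U)
  have hqX : ∀ v, qX v v = (1 + σ ^ 2) * ‖v‖ ^ 2 := fun v => by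
    simp only [qX, LinearMap.compl₁₂_apply, obsCov_self, toEuclideanLin_transpose_apply_self hU,
      norm_sq_toEuclideanLin hU]
    ring
  have hqZ : ∀ w, qZ w w = σ ^ 2 * ‖complProj U w‖ ^ 2 := fun w => by
    simp only [qZ, LinearMap.compl₁₂_apply, obsCov_self, transpose_complProj hU, norm_zero]
    ring
  have hqZτ : ∀ w, qZ w w ≤ τ * ‖w‖ ^ 2 := fun w => by
    rw [hqZ]
    have h1 : σ ^ 2 ≤ τ := by rw [hτ]; linarith [div_nonneg (by positivity : (0 : ℝ) ≤ d) hn'.le]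
    exact mul_le_mul h1 (norm_sq_complProj_le hU w) (by positivity) hτ0.le
  let B₁ : Set (Fin N → EuclideanSpace ℝ (Fin n) × EuclideanSpace ℝ (Fin n)) :=
    {D | ¬ ∀ v, |∑ k, (X v (D k) ^ 2 - qX v v)| ≤ N / 4 * ‖v‖ ^ 2}
  let B₂ : Set (Fin N → EuclideanSpace ℝ (Fin n) × EuclideanSpace ℝ (Fin n)) :=
    {D | ¬ ∀ w, |∑ k, (Z w (D k) ^ 2 - qZ w w)| ≤ N / 4 * ‖w‖ ^ 2}
  let B₃ : Set (Fin N → EuclideanSpace ℝ (Fin n) × EuclideanSpace ℝ (Fin n)) :=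
    {D | (∀ v, ∑ k, X v (D k) ^ 2 ≤ 2 * a * ‖v‖ ^ 2) ∧
      ¬ ∀ v w, ∑ k, X v (D k) * Z w (D k) ≤ 8 * √(5 * n * (τ * a)) * (‖v‖ * ‖w‖)}
  have hB₁ : (trainingLaw U σ N).real B₁ ≤ 1 / 2 * Real.exp (-d) := by
    have h := measure_pi_covariance_concentration (μ := jointLaw U σ) X
      (fun v => measurable_obsEval _) qX (fun v w => obsCov_symm U σ _ _)
      (fun v => by rw [hqX]; positivity) (fun v => map_obsEval_jointLaw U σ _)
      (τ := 1 + σ ^ 2) (by positivity) (fun v => (hqX v).le) N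
    rw [finrank_euclideanSpace_fin] at h
    refine (ENNReal.toReal_le_of_le_ofReal (by positivity) h).trans
      (le_trans ?_ (four_mul_pow_mul_exp_le hd))
    refine mul_le_mul_of_nonneg_left (exp_neg_div_le (by positivity) (le_trans ?_ hN))
      (by positivity)
    -- The factor 2 here explains the sample size constant: `229376 = 2 · 7 · 16384`.
    have h1 : (d : ℝ) * (1 + (1 + σ ^ 2)) ≤ 2 * (d + n * σ ^ 2) := by
      nlinarith [mul_le_mul_of_nonneg_right hdn' (sq_nonneg σ)]
    have := mul_le_mul_of_nonneg_left h1 (by positivity : 0 ≤ 1 + σ ^ 2)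
    nlinarith
  have hB₂ : (trainingLaw U σ N).real B₂ ≤ 1 / 2 * Real.exp (-n) := by
    have h := measure_pi_covariance_concentration (μ := jointLaw U σ) Z
      (fun v => measurable_obsEval _) qZ (fun v w => obsCov_symm U σ _ _)
      (fun w => by rw [hqZ]; positivity) (fun v => map_obsEval_jointLaw U σ _)
      hτ0 hqZτ N
    rw [finrank_euclideanSpace_fin] at h
    refine (ENNReal.toReal_le_of_le_ofReal (by positivity) h).trans
      (le_trans ?_ (four_mul_pow_mul_exp_le hn1))
    refine mul_le_mul_of_nonneg_left (exp_neg_div_le (by positivity) (le_trans ?_ hN))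
      (by positivity)
    have h1 : n * (τ * (1 + τ)) ≤ (d + n * σ ^ 2) * (2 * (1 + σ ^ 2)) := by
      rw [← mul_assoc, hnτ]
      exact mul_le_mul_of_nonneg_left (by nlinarith) (by positivity)
    nlinarith
  have hB₃ : (trainingLaw U σ N).real B₃ ≤ Real.exp (-n) := by
    have h := measure_pi_cross_covariance_concentration (μ := jointLaw U σ) X
      (fun v => measurable_obsEval _) Z (fun v => measurable_obsEval _)
      (fun v w => indepFun_obsEval U σ (transpose_complProj hU w) (by
        rw [inner_toEuclideanLin_left, transpose_complProj hU, inner_zero_right]))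
      (fun w => qZ w w) (fun w => by
        rw [hqZ]; positivity) (fun v => map_obsEval_jointLaw U σ _) hτ0 hqZτ N ha0
      (u := 5 * n) (by positivity)
    rw [finrank_euclideanSpace_fin, finrank_euclideanSpace_fin] at h
    exact (ENNReal.toReal_le_of_le_ofReal (by positivity) h).trans (pow_mul_pow_mul_exp_le hdn.le)
  have hsub : {D | ¬ ∀ V : Matrix (Fin n) (Fin d) ℝ,
      IsLeadingSingularVectors hdn.le (obsMatrix D * (obsMatrix D)ᵀ) V →
        d - ((Uᵀ * V)ᵀ * (Uᵀ * V)).trace ≤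
          5120 * d * ((1 + σ ^ 2) * (d + n * σ ^ 2)) / N} ⊆ (B₁ ∪ B₂) ∪ B₃ := by
    intro D hD
    by_contra hcon
    simp only [Set.mem_union, not_or] at hcon
    obtain ⟨⟨hD1, hD2⟩, hD3⟩ := hcon
    simp only [B₁, B₂, B₃, Set.mem_ofPred_eq, not_not, not_and] at hD1 hD2 hD3
    have hD3' := hD3 fun v => by
      have h := (abs_le.1 (hD1 v)).2
      rw [Finset.sum_sub_distrib, Finset.sum_const, Finset.card_univ, Fintype.card_fin,
        nsmul_eq_mul, hqX] at h
      have h2 : N / 4 * ‖v‖ ^ 2 ≤ a * ‖v‖ ^ 2 := by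
        refine mul_le_mul_of_nonneg_right ?_ (sq_nonneg _)
        rw [ha]; nlinarith [sq_nonneg σ]
      rw [ha] at h2 ⊢
      linarith
    refine hD fun V hV => ?_
    refine (sinTheta_le_of_covariance_bounds hdn hN0 hU (by positivity) hD1 hD2 hD3' hV).trans
      (le_of_eq ?_)
    -- With `r² = 64 · 5nτa`, the bound `16 r² d / N²` has constant `16 · 64 · 5 = 5120`.
    have e : 5 * n * (τ * a) = 5 * (d + n * σ ^ 2) * (N * (1 + σ ^ 2)) := by
      rw [← hnτ, ha]; ring
    rw [mul_pow, Real.sq_sqrt (by positivity), e]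
    field_simp
    ring
  have hprob : IsProbabilityMeasure (trainingLaw U σ N) := by unfold trainingLaw; infer_instance
  have hexp : Real.exp (-(n : ℝ)) ≤ Real.exp (-d) := Real.exp_le_exp.2 (by linarith)
  have h1 := measureReal_mono (μ := trainingLaw U σ N) hsub
  have h2 := measureReal_union_le (μ := trainingLaw U σ N) (B₁ ∪ B₂) B₃
  have h3 := measureReal_union_le (μ := trainingLaw U σ N) B₁ B₂
  linarith

end GoodEvent

end SubspaceDenoising

/-! ### Assembly of the risk bound -/

theorem theorem1 :
    ∃ c : ℝ, 0 < c ∧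
      ∀ (n d : ℕ) (_ : 1 ≤ d) (hdn : d < n) (σ : ℝ) (_ : 0 ≤ σ)
        (U : Matrix (Fin n) (Fin d) ℝ) (_ : Uᵀ * U = 1),
        (∀ W : Matrix (Fin n) (Fin n) ℝ,
          SubspaceDenoising.risk U σ (SubspaceDenoising.projEst U σ) ≤
            SubspaceDenoising.risk U σ W) ∧
        SubspaceDenoising.risk U σ (SubspaceDenoising.projEst U σ) = σ ^ 2 / (1 + σ ^ 2) ∧
        ∀ N : ℕ, ((d : ℝ) + n * σ ^ 2) * Real.log n ≤ N →
          1 - (n : ℝ) ^ (-10 : ℤ) - 3 * Real.exp (-(d : ℝ)) + Real.exp (-(n : ℝ)) ≤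
            (SubspaceDenoising.trainingLaw U σ N).real
              {D | ∀ Uhat : Matrix (Fin n) (Fin d) ℝ,
                SubspaceDenoising.IsLeadingSingularVectors hdn.le
                  (SubspaceDenoising.obsMatrix D * (SubspaceDenoising.obsMatrix D)ᵀ) Uhat →
                SubspaceDenoising.risk U σ (SubspaceDenoising.projEst Uhat σ) ≤
                  SubspaceDenoising.risk U σ (SubspaceDenoising.projEst U σ) +
                    c * (((d : ℝ) + n * σ ^ 2) * Real.log n / N)} := by
  open SubspaceDenoising in
  -- `1048576 = 2 · 524288`: the excess-risk factor `2/(1 + σ²)` times the sample threshold at which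
  -- the trivial bound stops being used.
  refine ⟨1048576, by norm_num, fun n d hd hdn σ _ U hU =>
    ⟨risk_projEst_self_le hd hU σ, risk_projEst_self hd hU σ, fun N hN => ?_⟩⟩
  have hd' : (1 : ℝ) ≤ d := by exact_mod_cast hd
  have hn2 : (2 : ℝ) ≤ n := by exact_mod_cast (by omega : 2 ≤ n)
  have hdn' : (d : ℝ) ≤ n := by exact_mod_cast hdn.le
  have hlog : 1 / 2 ≤ Real.log n := by
    have := Real.log_le_log (by norm_num) hn2
    linarith [Real.log_two_gt_d9]
  have hs : 0 ≤ σ ^ 2 := sq_nonneg σ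
  set Y : ℝ := d + n * σ ^ 2 with hY
  have hY0 : 0 < Y := by positivity
  have hN0 : (0 : ℝ) < N := lt_of_lt_of_le (by positivity) hN
  have hprob : IsProbabilityMeasure (trainingLaw U σ N) := by unfold trainingLaw; infer_instance
  -- This makes the allowed failure probability at least `3e^{-d} - e^{-n} ≥ 2e^{-d}`, which is what
  -- subspace recovery costs.
  have hexp : Real.exp (-(n : ℝ)) ≤ Real.exp (-d) := Real.exp_le_exp.2 (by linarith)
  have hpow : (0 : ℝ) ≤ (n : ℝ) ^ (-10 : ℤ) := by positivity
  have hed := Real.exp_pos (-(d : ℝ))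
  have hα : (1 + 2 * σ ^ 2) / (1 + σ ^ 2) ^ 2 ≤ 2 / (1 + σ ^ 2) := by
    rw [div_le_div_iff₀ (by positivity) (by positivity)]
    nlinarith
  -- the excess risk in terms of the subspace distance
  have hexcess : ∀ V : Matrix (Fin n) (Fin d) ℝ, Vᵀ * V = 1 → ∀ t : ℝ,
      d - ((Uᵀ * V)ᵀ * (Uᵀ * V)).trace ≤ d * t →
      2 / (1 + σ ^ 2) * t ≤ 1048576 * (Y * Real.log n / N) →
      risk U σ (projEst V σ) ≤ risk U σ (projEst U σ) + 1048576 * (Y * Real.log n / N) := by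
    intro V hV t ht htY
    have hD0 : 0 ≤ (d : ℝ) - ((Uᵀ * V)ᵀ * (Uᵀ * V)).trace := by
      have := trace_transpose_mul_le hU V
      rw [hV] at this
      simp only [Matrix.trace_one, Fintype.card_fin] at this
      linarith
    have ht0 : 0 ≤ t := by nlinarith
    rw [risk_projEst hd hU hV, risk_projEst_self hd hU, add_le_add_iff_left, mul_div_assoc]
    have h1 : ((d : ℝ) - ((Uᵀ * V)ᵀ * (Uᵀ * V)).trace) / d ≤ t := by
      rw [div_le_iff₀ (by positivity)]; linarith
    refine le_trans (mul_le_mul hα h1 (by positivity) (by positivity)) htY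
  -- The assumed sample size lacks the factor `1 + σ²` that concentration needs. Below the
  -- threshold, `D ≤ d` gives excess risk at most `2/(1 + σ²)`, already within the claimed bound.
  -- Above it, `log n ≥ 1/2` yields `524288/2 ≥ 229376`, so recovery applies.
  rcases lt_or_ge (N : ℝ) (524288 * ((1 + σ ^ 2) * (Y * Real.log n))) with hsmall | hlarge
  · have huniv : {D | ∀ Uhat : Matrix (Fin n) (Fin d) ℝ,
        IsLeadingSingularVectors hdn.le (obsMatrix D * (obsMatrix D)ᵀ) Uhat →
          risk U σ (projEst Uhat σ) ≤ risk U σ (projEst U σ) + 1048576 * (Y * Real.log n / N)} =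
        (Set.univ : Set (Fin N → EuclideanSpace ℝ (Fin n) × EuclideanSpace ℝ (Fin n))) := by
      refine Set.eq_univ_of_forall fun D V hV => hexcess V hV.transpose_mul_self 1 ?_ ?_
      · have := trace_transpose_mul_self_nonneg (Uᵀ * V)
        linarith
      · rw [mul_one, ← mul_div_assoc, div_le_div_iff₀ (by positivity) hN0]
        nlinarith
    rw [huniv, probReal_univ]
    linarith
  · have hN' : 229376 * ((1 + σ ^ 2) * Y) ≤ (N : ℝ) := by
      refine le_trans ?_ hlarge
      have : 0 < (1 + σ ^ 2) * Y := by positivity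
      nlinarith
    have hbad := trainingLaw_sinTheta_le hd hdn hU σ hN'
    set S := {D : Fin N → EuclideanSpace ℝ (Fin n) × EuclideanSpace ℝ (Fin n) |
      ∀ Uhat : Matrix (Fin n) (Fin d) ℝ,
        IsLeadingSingularVectors hdn.le (obsMatrix D * (obsMatrix D)ᵀ) Uhat →
          risk U σ (projEst Uhat σ) ≤
            risk U σ (projEst U σ) + 1048576 * (Y * Real.log n / N)} with hS
    set B := {D : Fin N → EuclideanSpace ℝ (Fin n) × EuclideanSpace ℝ (Fin n) |
      ¬ ∀ V : Matrix (Fin n) (Fin d) ℝ,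
        IsLeadingSingularVectors hdn.le (obsMatrix D * (obsMatrix D)ᵀ) V →
          d - ((Uᵀ * V)ᵀ * (Uᵀ * V)).trace ≤ 5120 * d * ((1 + σ ^ 2) * Y) / N} with hB
    -- Subadditivity on a cover gives `1 ≤ P(S) + P(B)` without requiring `S` or `B` to be
    -- measurable.
    have hcover : (Set.univ : Set (Fin N → EuclideanSpace ℝ (Fin n) × EuclideanSpace ℝ (Fin n)))
        ⊆ S ∪ B := by
      intro D _
      by_cases hD : D ∈ B
      · exact Or.inr hD
      · refine Or.inl fun V hV => ?_
        rw [hB, Set.mem_ofPred_eq, not_not] at hD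
        refine hexcess V hV.transpose_mul_self (5120 * ((1 + σ ^ 2) * Y) / N)
          ((hD V hV).trans (le_of_eq (by ring))) ?_
        have e : 2 / (1 + σ ^ 2) * (5120 * ((1 + σ ^ 2) * Y) / N) = 10240 * Y / N := by
          field_simp; ring
        rw [e, ← mul_div_assoc]
        refine div_le_div_of_nonneg_right ?_ hN0.le
        nlinarith
    have h1 := (measureReal_mono (μ := trainingLaw U σ N) hcover).trans (measureReal_union_le S B)
    rw [probReal_univ] at h1
    linarith
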